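/- Let $k\ge 1$, let $A_1,\dots,A_k\subset\mathbb R^d$ ($d\ge 2$) be linear subspaces whose orthogonal complements $L_i=A_i^\perp$ satisfy $\dim L_i\ge 2$, let $r_1,\dots,r_k>0$, and let $P_i$ denote the orthogonal projection of $\mathbb R^d$ onto $L_i$. Fix a symbolic collision sequence $\Sigma=(\sigma(1),\dots,\sigma(m))\in\{1,\dots,k\}^m$. A Euclidean path with collision sequence $\Sigma$ is a continuous, piecewise linear curve $\gamma:[0,\infty)\to\mathbb R^d$ with $\gamma(0)=0$ and $\|\dot\gamma\|=1$ whose velocity jumps exactly at times $0<t_1<\dots<t_m$, the jumps $w_j=\dot\gamma(t_j+0)-\dot\gamma(t_j-0)$ being non-zero elements of $L_{\sigma(j)}$. Let $\Gamma(\Sigma)$ be the set of these paths. For $\gamma\in\Gamma(\Sigma)$ put $V_0(\gamma)=\dot\gamma(0)$, $V_m(\gamma)=\dot\gamma(t_m+0)$ (with $V_m=V_0$ if $m=0$), and $$a_j(\gamma)=P_{\sigma(j)}(\gamma(t_j))-r_{\sigma(j)}\frac{w_j}{\|w_j\|}\in L_{\sigma(j)},\qquad j=1,\dots,m$$ (so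 that the $j$-th collision takes place at the boundary of the translate by $a_j(\gamma)$ of the cylinder $\{x:\operatorname{dist}(x,A_{\sigma(j)})<r_{\sigma(j)}\}$). A path $\gamma$ is determined by $V_0(\gamma)$ and $a_1(\gamma),\dots,a_m(\gamma)$. For $a\in\mathbb R^d$ of small norm let $T_a(\gamma)\in\Gamma(\Sigma)$ be the unique path $\delta$ with $V_0(\delta)=V_0(\gamma)$ and $a_j(\delta)-a_j(\gamma)=P_{\sigma(j)}(a)$ for all $j$. Define the positive subspace $$\mathcal W_+(\gamma)=\Bigl\{\lim_{\epsilon\to0}\epsilon^{-1}\bigl(V_m(T_{\epsilon a}(\gamma))-V_m(\gamma)\bigr):\ a\in\mathbb R^d\Bigr\}.$$ For $\vec a=(a_1,\dots,a_m)\in\prod_{j=1}^m L_{\sigma(j)}$ let $$\Gamma(\Sigma,\vec a)=\{\gamma\in\Gamma(\Sigma):\ \exists\,a\in\mathbb R^d\ \text{ such that }\ a_j(\gamma)-a_j=P_{\sigma(j)}(a)\ \text{ for } j=1,\dots,m\},$$ and define the typical dimensions $$\Delta(\Sigma)=\max_{\gamma\in\Gamma(\Sigma)}\dim\mathcal W_+(\gamma),\qquad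 \Delta(\Sigma,\vec a)=\max_{\gamma\in\Gamma(\Sigma,\vec a)}\dim\mathcal W_+(\gamma).$$ Key Lemma 3.17. If $\Gamma(\Sigma,\vec a)\ne\emptyset$, then $\Delta(\Sigma)=\Delta(\Sigma,\vec a)$. -/

import Mathlib

open scoped NNReal

noncomputable section

/-- Generator subspaces `A i` of `ℝᵈ` and radii `r i > 0` of finitely many spherical cylinders
`{x | dist (x, A i) < r i}`; the base subspaces `(A i)ᗮ` have dimension at least two. -/
structure CylinderSystem (d k : ℕ) where
  A : Fin k → Submodule ℝ (EuclideanSpace ℝ (Fin d))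
  r : Fin k → ℝ
  r_pos : ∀ i, 0 < r i
  two_le_finrank : ∀ i, 2 ≤ Module.finrank ℝ ((A i)ᗮ : Submodule ℝ (EuclideanSpace ℝ (Fin d)))

/-- The base subspace `L i`, the orthogonal complement of `A i`. -/
def CylinderSystem.L {d k : ℕ} (S : CylinderSystem d k) (i : Fin k) :
    Submodule ℝ (EuclideanSpace ℝ (Fin d)) :=
  (S.A i)ᗮ

/-- The orthogonal projection `P i` of `ℝᵈ` onto `L i`. -/
def CylinderSystem.P {d k : ℕ} (S : CylinderSystem d k) (i : Fin k) :
    EuclideanSpace ℝ (Fin d) →L[ℝ] EuclideanSpace ℝ (Fin d) :=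
  (S.L i).starProjection

/-- For collision times `t 0 < ⋯ < t (m - 1)`, the closed time interval that follows exactly the
first `j` collisions: `[t (j - 1), t j]`, with left end `0` for `j = 0`, and unbounded to the right
for `j = m`. -/
def timeSegment {m : ℕ} (t : Fin m → ℝ≥0) (j : Fin (m + 1)) : Set ℝ≥0 :=
  {s | (∀ i : Fin m, i.castSucc < j → t i ≤ s) ∧ (∀ i : Fin m, j ≤ i.castSucc → s ≤ t i)}

theorem exists_mem_timeSegment {m : ℕ} {t : Fin m → ℝ≥0} (ht : Monotone t) (s : ℝ≥0) :
    ∃ j, s ∈ timeSegment t j := by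
  by_cases h : ∃ i, t i ≤ s
  · obtain ⟨i, hi, hmax⟩ := (Set.toFinite {i | t i ≤ s}).exists_maximal h
    refine ⟨i.succ, fun l hl => ?_, fun l hl => ?_⟩
    · exact (ht (by
        simp only [Fin.lt_def, Fin.le_def, Fin.val_succ, Fin.val_castSucc] at hl ⊢; omega)).trans hi
    · by_contra hlt
      have h1 : l ≤ i := by
        by_contra hli
        exact hli (hmax (show t l ≤ s from (not_le.1 hlt).le) (not_le.1 hli).le)
      simp only [Fin.le_def, Fin.val_succ, Fin.val_castSucc] at hl h1
      omega
  · push Not at h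
    exact ⟨0, fun i hi => absurd hi (by simp), fun i _ => (h i).le⟩

/-- A Euclidean path with the symbolic collision sequence `σ`: a continuous piecewise linear curve
on `[0, ∞)` starting at the origin and parametrized by arc length, with collisions at the times
`time j`, at which its velocity jumps from `vel j.castSucc` to `vel j.succ` by a nonzero vector of
the base subspace `L (σ j)`. So the velocity history of the path is `vel 0, …, vel m`. The collision
times and the velocities are determined by the curve. -/
@[ext]
structure EuclideanPath {d k m : ℕ} (S : CylinderSystem d k) (σ : Fin m → Fin k) where
  curve : ℝ≥0 → EuclideanSpace ℝ (Fin d)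
  time : Fin m → ℝ≥0
  vel : Fin (m + 1) → EuclideanSpace ℝ (Fin d)
  curve_zero : curve 0 = 0
  time_pos : ∀ j, 0 < time j
  time_strictMono : StrictMono time
  norm_vel : ∀ j, ‖vel j‖ = 1
  linear : ∀ j, ∀ s ∈ timeSegment time j, ∀ s' ∈ timeSegment time j,
    curve s' - curve s = ((s' : ℝ) - (s : ℝ)) • vel j
  jump_ne_zero : ∀ j : Fin m, vel j.succ - vel j.castSucc ≠ 0
  jump_mem : ∀ j : Fin m, vel j.succ - vel j.castSucc ∈ S.L (σ j)

namespace EuclideanPath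

variable {d k m : ℕ} {S : CylinderSystem d k} {σ : Fin m → Fin k}

/-- The velocity change at the `j`-th collision. -/
def jump (γ : EuclideanPath S σ) (j : Fin m) : EuclideanSpace ℝ (Fin d) :=
  γ.vel j.succ - γ.vel j.castSucc

/-- The translation vector `a_j(γ) ∈ L (σ j)` of the cylinder at whose boundary the `j`-th
collision takes place. -/
def cylinderPos (γ : EuclideanPath S σ) (j : Fin m) : EuclideanSpace ℝ (Fin d) :=
  S.P (σ j) (γ.curve (γ.time j)) - S.r (σ j) • (‖γ.jump j‖⁻¹ • γ.jump j)

theorem cylinderPos_mem (γ : EuclideanPath S σ) (j : Fin m) : γ.cylinderPos j ∈ S.L (σ j) :=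
  Submodule.sub_mem _ (Submodule.starProjection_apply_mem _ _)
    (Submodule.smul_mem _ _ (Submodule.smul_mem _ _ (γ.jump_mem j)))

/-- The final velocity `V_m(γ)`. -/
def finalVel (γ : EuclideanPath S σ) : EuclideanSpace ℝ (Fin d) :=
  γ.vel (Fin.last m)

/-- `δ` arises from `γ` by translating all the cylinders by the vector `a` and keeping the initial
velocity: `δ = T_a(γ)`. -/
def IsTranslate (a : EuclideanSpace ℝ (Fin d)) (γ δ : EuclideanPath S σ) : Prop :=
  δ.vel 0 = γ.vel 0 ∧ ∀ j, δ.cylinderPos j - γ.cylinderPos j = S.P (σ j) a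

/-- The incoming velocity points strictly into the cylinder. -/
theorem inner_vel_jump (γ : EuclideanPath S σ) (j : Fin m) :
    inner ℝ (γ.vel j.castSucc) (γ.jump j) = - (‖γ.jump j‖ ^ 2 / 2) := by
  have h1 : γ.vel j.succ = γ.vel j.castSucc + γ.jump j := by simp [jump]
  have h2 := norm_add_sq_real (γ.vel j.castSucc) (γ.jump j)
  rw [← h1, γ.norm_vel, γ.norm_vel] at h2
  linarith

/-- A Euclidean path is determined by its initial velocity and its cylinder positions. -/
theorem eq_of_data {γ δ : EuclideanPath S σ} (hV : γ.vel 0 = δ.vel 0)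
    (ha : ∀ j, γ.cylinderPos j = δ.cylinderPos j) : γ = δ := by
  have step : ∀ j : Fin m, γ.vel j.castSucc = δ.vel j.castSucc →
      (∃ s, s ∈ timeSegment γ.time j.castSucc ∧ s ∈ timeSegment δ.time j.castSucc ∧
        γ.curve s = δ.curve s) →
      γ.time j = δ.time j ∧ γ.vel j.succ = δ.vel j.succ ∧
        γ.curve (γ.time j) = δ.curve (δ.time j) := by
    rintro j hj ⟨s, hs, hs', hc⟩
    have key : ∀ η : EuclideanPath S σ, s ∈ timeSegment η.time j.castSucc →
        η.curve (η.time j) - η.curve s = ((η.time j : ℝ) - s) • η.vel j.castSucc := by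
      intro η h
      refine η.linear _ _ h _ ⟨fun i hi => ?_, fun i hi => ?_⟩
      · exact η.time_strictMono.monotone (Fin.castSucc_lt_castSucc_iff.1 hi).le
      · exact η.time_strictMono.monotone (Fin.castSucc_le_castSucc_iff.1 hi)
    have e1 := key γ hs
    have e2 := key δ hs'
    set v := γ.vel j.castSucc with hv
    rw [← hj, ← hc] at e2
    have hpos : ∀ η : EuclideanPath S σ, 0 < ‖η.jump j‖ := fun η =>
      norm_pos_iff.2 (η.jump_ne_zero j)
    set n := ‖γ.jump j‖⁻¹ • γ.jump j with hn
    set n' := ‖δ.jump j‖⁻¹ • δ.jump j with hn'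
    have nL : ∀ η : EuclideanPath S σ, ‖η.jump j‖⁻¹ • η.jump j ∈ S.L (σ j) := fun η =>
      Submodule.smul_mem _ _ (η.jump_mem j)
    have n1 : ‖n‖ = 1 := by
      rw [hn, norm_smul, norm_inv, norm_norm, inv_mul_cancel₀ (hpos γ).ne']
    have n1' : ‖n'‖ = 1 := by
      rw [hn', norm_smul, norm_inv, norm_norm, inv_mul_cancel₀ (hpos δ).ne']
    have i1 : inner ℝ v n = - (‖γ.jump j‖ / 2) := by
      rw [hn, inner_smul_right, γ.inner_vel_jump]; field_simp [(hpos γ).ne']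
    have i2 : inner ℝ v n' = - (‖δ.jump j‖ / 2) := by
      rw [hn', inner_smul_right, hj, δ.inner_vel_jump]; field_simp [(hpos δ).ne']
    have hr := S.r_pos (σ j)
    set c : ℝ := (δ.time j : ℝ) - γ.time j with hcdef
    have e3 : δ.curve (δ.time j) - γ.curve (γ.time j) = c • v := by
      rw [hcdef, show ((δ.time j : ℝ) - γ.time j) = (δ.time j - s) - (γ.time j - s) by ring,
        sub_smul, ← e1, ← e2]; abel
    have e4 : c • S.P (σ j) v = S.r (σ j) • (n' - n) := by
      rw [← map_smul, ← e3, map_sub]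
      have := ha j
      simp only [cylinderPos, ← hn, ← hn'] at this
      rw [smul_sub, sub_eq_sub_iff_add_eq_add]
      rw [sub_eq_sub_iff_add_eq_add] at this
      rw [add_comm (S.r (σ j) • n')]
      rw [← this]
    have hP : ∀ x ∈ S.L (σ j), inner ℝ (S.P (σ j) v) x = inner ℝ v x := by
      intro x hx
      have := Submodule.inner_starProjection_left_eq_right (S.L (σ j)) v x
      rw [Submodule.starProjection_eq_self_iff.2 hx] at this
      exact this
    have e5 : c * inner ℝ v (n' + n) = 0 := by
      have hmem : n' + n ∈ S.L (σ j) := Submodule.add_mem _ (nL δ) (nL γ)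
      rw [← hP _ hmem, ← real_inner_smul_left, e4, real_inner_smul_left]
      have : inner ℝ (n' - n) (n' + n) = 0 := by
        rw [real_inner_comm, real_inner_add_sub_eq_zero_iff, n1, n1']
      rw [this, mul_zero]
    have hc0 : c = 0 := by
      rcases mul_eq_zero.1 e5 with h | h
      · exact h
      · rw [inner_add_right, i1, i2] at h
        have := hpos γ; have := hpos δ; linarith
    have hnn : n' = n := by
      rw [hc0, zero_smul] at e4
      exact sub_eq_zero.1 ((smul_eq_zero.1 e4.symm).resolve_left hr.ne')
    refine ⟨?_, ?_, ?_⟩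
    · exact_mod_cast (sub_eq_zero.1 hc0).symm
    · have hJ : γ.jump j = δ.jump j := by
        have hnorm : ‖γ.jump j‖ = ‖δ.jump j‖ := by rw [hnn, i1] at i2; linarith
        have a1 : γ.jump j = ‖γ.jump j‖ • n := by rw [hn, smul_inv_smul₀ (hpos γ).ne']
        have a2 : δ.jump j = ‖δ.jump j‖ • n' := by rw [hn', smul_inv_smul₀ (hpos δ).ne']
        rw [a1, a2, hnn, hnorm]
      have b1 : γ.vel j.succ = γ.vel j.castSucc + γ.jump j := by simp [jump]
      have b2 : δ.vel j.succ = δ.vel j.castSucc + δ.jump j := by simp [jump]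
      rw [b1, b2, ← hj, hJ]
    · rw [hc0, zero_smul] at e3; exact (sub_eq_zero.1 e3).symm
  have main : ∀ j : Fin (m + 1), γ.vel j = δ.vel j ∧
      (∃ s, s ∈ timeSegment γ.time j ∧ s ∈ timeSegment δ.time j ∧ γ.curve s = δ.curve s) := by
    intro j
    induction j using Fin.induction with
    | zero =>
      refine ⟨hV, 0, ?_, ?_, by rw [γ.curve_zero, δ.curve_zero]⟩ <;>
      exact ⟨fun i hi => absurd hi (by simp), fun i _ => bot_le⟩
    | succ j ih =>
      obtain ⟨h1, h2, h3⟩ := step j ih.1 ih.2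
      have seg : ∀ η : EuclideanPath S σ, η.time j ∈ timeSegment η.time j.succ := fun η =>
        ⟨fun i hi => η.time_strictMono.monotone (by
          simp only [Fin.lt_def, Fin.le_def, Fin.val_succ, Fin.val_castSucc] at hi ⊢; omega),
         fun i hi => η.time_strictMono.monotone (by
          simp only [Fin.le_def, Fin.val_succ, Fin.val_castSucc] at hi ⊢; omega)⟩
      refine ⟨h2, γ.time j, seg γ, ?_, ?_⟩
      · rw [h1]; exact seg δ
      · rw [h3, h1]
  have ht : γ.time = δ.time := funext fun j => (step j (main _).1 (main _).2).1
  have hv : γ.vel = δ.vel := funext fun j => (main j).1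
  refine EuclideanPath.ext ?_ ht hv
  funext s
  obtain ⟨j, hj⟩ : ∃ j, s ∈ timeSegment γ.time j :=
    exists_mem_timeSegment γ.time_strictMono.monotone s
  obtain ⟨_, s₀, h0, h0', h0c⟩ := main j
  have a1 := γ.linear j _ h0 _ hj
  have a2 := δ.linear j _ h0' _ (ht ▸ hj)
  rw [← hv, ← a1, ← h0c] at a2
  exact (sub_left_injective a2).symm

theorem IsTranslate.unique {a : EuclideanSpace ℝ (Fin d)} {γ δ δ' : EuclideanPath S σ}
    (h : IsTranslate a γ δ) (h' : IsTranslate a γ δ') : δ = δ' :=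
  eq_of_data (h.1.trans h'.1.symm) fun j => sub_left_injective ((h.2 j).trans (h'.2 j).symm)

open Classical in
/-- The translated path `T_a(γ)`, unique when it exists, which it does for small `a`. (The value
when it does not exist is immaterial: only the limit of small translations is used.) -/
def translate (a : EuclideanSpace ℝ (Fin d)) (γ : EuclideanPath S σ) : EuclideanPath S σ :=
  if h : ∃ δ, IsTranslate a γ δ then h.choose else γ

/-- `w` is the directional derivative `∂_a V_m` at `γ`, the derivative at `ε = 0` of
`V_m (T_{ε a} γ)`. -/
def IsVelDeriv (γ : EuclideanPath S σ) (a w : EuclideanSpace ℝ (Fin d)) : Prop :=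
  HasDerivAt (fun ε : ℝ => (translate (ε • a) γ).finalVel) w 0

/-- The positive subspace `W₊(γ)`, consisting of the derivatives `∂_a V_m` at `γ` for `a ∈ ℝᵈ`
(these already form a linear subspace; the span makes it a bundled one). -/
def posSubspace (γ : EuclideanPath S σ) : Submodule ℝ (EuclideanSpace ℝ (Fin d)) :=
  Submodule.span ℝ {w | ∃ a, IsVelDeriv γ a w}

/-- The set `Γ(Σ, a)` of the Euclidean paths whose cylinders have the relative positions given by
the multivector `a`. -/
def withRelativePositions (S : CylinderSystem d k) (σ : Fin m → Fin k) (a : ∀ j, S.L (σ j)) :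
    Set (EuclideanPath S σ) :=
  {γ | ∃ x : EuclideanSpace ℝ (Fin d),
    ∀ j, γ.cylinderPos j - (a j : EuclideanSpace ℝ (Fin d)) = S.P (σ j) x}

/-- The maximum of `dim W₊(γ)` over a set of Euclidean paths. -/
def maxDim (G : Set (EuclideanPath S σ)) : ℕ :=
  sSup ((fun γ => Module.finrank ℝ (posSubspace γ)) '' G)

theorem isGreatest_maxDim {G : Set (EuclideanPath S σ)} (hG : G.Nonempty) :
    IsGreatest ((fun γ => Module.finrank ℝ (posSubspace γ)) '' G) (maxDim G) := by
  have hb : BddAbove ((fun γ => Module.finrank ℝ (posSubspace γ)) '' G) :=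
    ⟨Module.finrank ℝ (EuclideanSpace ℝ (Fin d)), by
      rintro _ ⟨γ, -, rfl⟩; exact Submodule.finrank_le _⟩
  exact ⟨Nat.sSup_mem (hG.image _) hb, fun _ h => le_csSup hb h⟩

end EuclideanPath

/-- The typical dimension `Δ(Σ)` of `W₊` over all the Euclidean paths of `σ`. -/
def Delta {d k m : ℕ} (S : CylinderSystem d k) (σ : Fin m → Fin k) : ℕ :=
  EuclideanPath.maxDim (Set.univ : Set (EuclideanPath S σ))

/-- The typical dimension `Δ(Σ, a)` of `W₊` over the Euclidean paths with the relative cylinder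
positions given by `a`. -/
def DeltaRel {d k m : ℕ} (S : CylinderSystem d k) (σ : Fin m → Fin k) (a : ∀ j, S.L (σ j)) : ℕ :=
  EuclideanPath.maxDim (EuclideanPath.withRelativePositions S σ a)

end

/-! Translating all cylinders by a vector amounts to translating the starting point by its negative.
So the paths with given relative positions are the unit-speed trajectories of one fixed sequence of
cylinders with initial state `(-x, V₀)`, and `W₊` is the range of the derivative of the last
velocity in the initial position: the rank of a beam of parallel light (`posSubspace_eq_range`). The
claim becomes that the maximal rank does not depend on the centres of the cylinders.

The go-between is `velHist`, which composes reflections in freely prescribed normals and does not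
involve the centres. The last velocity of a trajectory is `velHist` of its normals, so the rank of a
beam is at most the rank of `velHist` in the normals (`finrank_velVar_le`). Conversely, ranks are
lower semicontinuous, so for the given centres some state `y` has all relevant ranks locally
constant; near it `velHist` has no larger rank than the beam (`eventually_finrank_le`). Since
`velHist` is analytic on a connected domain, the bound by the rank at `y` spreads to all normals,
including those of trajectories for other centres.

The comparison near `y` rests on `historiesRealized_succ`: each free history near that of `y` shares
its initial and `j`-th velocities with a nearby trajectory. A reflection preserves the norm and the
component orthogonal to `L j`. That component obeys a relation given by constant rank, which free
histories inherit by induction; the direction inside `L j` can be rotated at will by shifting the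
beam (`exists_vel_var_eq`), because the beam is dispersing: `⟨Q ζ, Y η⟩` is a symmetric positive
semidefinite form. -/

noncomputable section

open Filter Topology

/-! ### Factorization through a submersion. -/

section ConstantRank

variable {X Y Z : Type*} [NormedAddCommGroup X] [NormedSpace ℝ X] [FiniteDimensional ℝ X]
  [NormedAddCommGroup Y] [NormedSpace ℝ Y]
  [NormedAddCommGroup Z] [NormedSpace ℝ Z]

/-- If `f` is a submersion at `p` and the derivative of `g` vanishes along the fibres of `f` near
`p`, then `g` factors through `f` near `p`. -/
theorem exists_factor_of_ker_le_ker {f : X → Y} {g : X → Z} {p : X}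
    (hf : ContDiffAt ℝ 1 f p) (hg : ContDiffAt ℝ 1 g p)
    (hsurj : Function.Surjective (fderiv ℝ f p))
    (hker : ∀ᶠ z in 𝓝 p, ∀ u, fderiv ℝ f z u = 0 → fderiv ℝ g z u = 0) :
    ∃ ψ : Y → Z, ContDiffAt ℝ 1 ψ (f p) ∧ ∀ᶠ z in 𝓝 p, g z = ψ (f z) := by
  set f' := fderiv ℝ f p with hf'
  let K : Submodule ℝ X := LinearMap.ker (f' : X →ₗ[ℝ] Y)
  obtain ⟨P, hP⟩ : ∃ P : X →L[ℝ] K, ∀ k : K, P k = k :=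
    Submodule.ClosedComplemented.of_finiteDimensional K
  have hbij : Function.Bijective (f'.prod P : X →L[ℝ] Y × K) := by
    constructor
    · rw [injective_iff_map_eq_zero]
      intro x hx
      have h1 : f' x = 0 := congrArg Prod.fst hx
      have h2 : P x = 0 := congrArg Prod.snd hx
      have h3 := hP ⟨x, h1⟩
      rw [h2] at h3
      exact (congrArg Subtype.val h3).symm
    · rintro ⟨y, k⟩
      obtain ⟨x, hx⟩ := hsurj y
      refine ⟨x + ((k - P x : K) : X), Prod.ext ?_ ?_⟩
      · have : f' ((k - P x : K) : X) = 0 := (k - P x).2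
        show f' (x + _) = y
        rw [map_add, this, hx, add_zero]
      · show P (x + _) = k
        rw [map_add, hP]; abel
  let e : X ≃L[ℝ] Y × K :=
    (LinearEquiv.ofBijective ((f'.prod P : X →L[ℝ] Y × K) : X →ₗ[ℝ] Y × K)
      hbij).toContinuousLinearEquiv
  have he : (e : X →L[ℝ] Y × K) = f'.prod P := by ext x <;> rfl
  -- Local coordinates at `p` in which `f` is the first component and the fibres of `f` are slices.
  let Φ : X → Y × K := fun x => (f x, P x)
  have hΦ : ContDiffAt ℝ 1 Φ p := hf.prodMk P.contDiff.contDiffAt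
  have hΦ' : HasFDerivAt Φ (e : X →L[ℝ] Y × K) p := by
    rw [he]
    exact ((hf.differentiableAt one_ne_zero).hasFDerivAt).prodMk P.hasFDerivAt
  let h := hΦ.toOpenPartialHomeomorph Φ hΦ' one_ne_zero
  have hps : p ∈ h.source := hΦ.mem_toOpenPartialHomeomorph_source hΦ' one_ne_zero
  have hh : ∀ x, h x = Φ x := fun _ => rfl
  have hσ : ContDiffAt ℝ 1 h.symm (Φ p) := hΦ.to_localInverse hΦ' one_ne_zero
  have hσp : h.symm (Φ p) = p := h.left_inv hps
  have hpt : Φ p ∈ h.target := h.map_source hps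
  have hσc : Tendsto h.symm (𝓝 (Φ p)) (𝓝 p) := by
    have := hσ.continuousAt
    rwa [ContinuousAt, hσp] at this
  have hG : ContDiffAt ℝ 1 (fun w => g (h.symm w)) (Φ p) := by
    refine ContDiffAt.comp (Φ p) (g := g) ?_ hσ
    rwa [hσp]
  have hev : ∀ᶠ w in 𝓝 (Φ p), DifferentiableAt ℝ (fun w => g (h.symm w)) w ∧
      ∀ k : K, fderiv ℝ (fun w => g (h.symm w)) w (0, k) = 0 := by
    filter_upwards [hσ.eventually (by simp), h.open_target.mem_nhds hpt, hσc.eventually hker,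
      hσc.eventually (hf.eventually (by simp)), hσc.eventually (hg.eventually (by simp))]
      with w h1 h2 h3 h4 h5
    have d1 := (h1.differentiableAt one_ne_zero)
    have d4 := (h4.differentiableAt one_ne_zero)
    have d5 := (h5.differentiableAt one_ne_zero)
    have c5 : HasFDerivAt (fun w => g (h.symm w)) _ w := d5.hasFDerivAt.comp w d1.hasFDerivAt
    have c4 : HasFDerivAt (fun w => f (h.symm w)) _ w := d4.hasFDerivAt.comp w d1.hasFDerivAt
    refine ⟨c5.differentiableAt, fun k => ?_⟩
    have c4' : (fun w => f (h.symm w)) =ᶠ[𝓝 w] Prod.fst := by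
      filter_upwards [h.open_target.mem_nhds h2] with w' hw'
      exact congrArg Prod.fst (h.right_inv hw')
    have e4 := (c4.congr_of_eventuallyEq c4'.symm).unique hasFDerivAt_fst
    rw [c5.fderiv]
    refine h3 _ ?_
    have := congrArg (fun T : Y × K →L[ℝ] Y => T (0, k)) e4
    simpa using this
  obtain ⟨ε, hε, hball⟩ := Metric.eventually_nhds_iff_ball.1 hev
  -- In these coordinates `g` does not depend on the `K`-component, which may be frozen at `P p`.
  refine ⟨fun y => g (h.symm (y, P p)), ?_, ?_⟩
  · exact ContDiffAt.comp (f p) (g := fun w => g (h.symm w)) hG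
      (contDiffAt_id.prodMk contDiffAt_const)
  · have hΦc : Tendsto Φ (𝓝 p) (𝓝 (Φ p)) := hΦ.continuousAt
    filter_upwards [h.open_source.mem_nhds hps, hΦc.eventually (Metric.ball_mem_nhds _ hε)]
      with z hz hzb
    have hz1 : dist (f z) (f p) < ε := lt_of_le_of_lt (le_max_left _ _) hzb
    have hz2 : dist (P z) (P p) < ε := lt_of_le_of_lt (le_max_right _ _) hzb
    have hd : ∀ k ∈ Metric.ball (P p) ε,
        HasFDerivAt (fun k : K => g (h.symm (f z, k))) (0 : K →L[ℝ] Z) k := by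
      intro k hk
      have hw := hball (f z, k) (max_lt hz1 hk)
      have := HasFDerivAt.comp k (g := fun w => g (h.symm w)) hw.1.hasFDerivAt
        ((hasFDerivAt_const (f z) k).prodMk (hasFDerivAt_id k))
      refine this.congr_fderiv ?_
      ext k'
      simpa using hw.2 k'
    have hc := (convex_ball (P p) ε).is_const_of_fderivWithin_eq_zero (𝕜 := ℝ)
      (f := fun k : K => g (h.symm (f z, k)))
      (fun k hk => (hd k hk).differentiableAt.differentiableWithinAt)
      (fun k hk => by
        rw [fderivWithin_of_isOpen Metric.isOpen_ball hk, (hd k hk).fderiv])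
      (show P z ∈ _ from hz2) (Metric.mem_ball_self hε)
    have : h.symm (f z, P z) = z := h.left_inv hz
    simpa only [this] using hc

end ConstantRank

/-! ### Semicontinuity and analytic continuation of ranks. -/

section Rank

variable {X Y E : Type*} [NormedAddCommGroup X] [NormedSpace ℝ X]
  [NormedAddCommGroup Y] [NormedSpace ℝ Y] [FiniteDimensional ℝ Y]

theorem eventually_finrank_range_le {α : Type*} [TopologicalSpace α] {T : α → X →L[ℝ] Y} {p : α}
    (hT : ContinuousAt T p) :
    ∀ᶠ z in 𝓝 p, Module.finrank ℝ (T p).range ≤ Module.finrank ℝ (T z).range := by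
  have key : ∀ S : X →L[ℝ] Y, ((Module.finrank ℝ S.range : ℕ) : Cardinal) =
      (S : X →ₗ[ℝ] Y).rank := fun S => Module.finrank_eq_rank _ _
  have := hT.eventually ((isOpen_setOfPred_nat_le_rank (𝕜 := ℝ) (E := X) (F := Y)
    (Module.finrank ℝ (T p).range)).mem_nhds (by
      show ((Module.finrank ℝ (T p).range : ℕ) : Cardinal) ≤ _
      rw [key]))
  filter_upwards [this] with z hz
  have h2 : ((Module.finrank ℝ (T p).range : ℕ) : Cardinal) ≤ ((T z : X →ₗ[ℝ] Y)).rank := hz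
  rw [← key] at h2
  exact_mod_cast h2

/-- Finitely many bounded lower semicontinuous integer functions are simultaneously locally
constant at some point of a nonempty open set. -/
theorem exists_eventually_const {α ι : Type*} [TopologicalSpace α] [Fintype ι] {U : Set α}
    (hU : IsOpen U) (hne : U.Nonempty) {ρ : ι → α → ℕ} {N : ℕ} (hN : ∀ i z, ρ i z ≤ N)
    (hρ : ∀ i, ∀ z ∈ U, ∀ᶠ z' in 𝓝 z, ρ i z ≤ ρ i z') :
    ∃ z ∈ U, ∀ i, ∀ᶠ z' in 𝓝 z, ρ i z' = ρ i z := by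
  have hb : BddAbove ((fun z => ∑ i, ρ i z) '' U) := by
    refine ⟨∑ _i : ι, N, ?_⟩
    rintro _ ⟨z, -, rfl⟩
    exact Finset.sum_le_sum fun i _ => hN i z
  -- At a maximum of the sum no term can drop nearby, hence none can rise.
  obtain ⟨z, hz, hmax⟩ := Nat.sSup_mem (hne.image _) hb
  refine ⟨z, hz, fun i => ?_⟩
  filter_upwards [eventually_all.2 fun i => hρ i z hz, hU.mem_nhds hz] with z' h1 h2
  have h3 : ∑ i, ρ i z' ≤ ∑ i, ρ i z := by
    have := le_csSup hb (Set.mem_image_of_mem _ h2)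
    rw [← hmax] at this
    exact this
  exact (((Finset.sum_eq_sum_iff_of_le fun i _ => h1 i).1
    (le_antisymm (Finset.sum_le_sum fun i _ => h1 i) h3)) i (Finset.mem_univ i)).symm

/-- A larger rank at `e` would give a minor of that size that is nonzero at `e`. It is analytic and
vanishes near `e₀`, hence on all of `U`. -/
theorem finrank_range_le_of_eventually_le [NormedAddCommGroup E] [NormedSpace ℝ E]
    {T : E → X →L[ℝ] Y} {U : Set E} (hT : AnalyticOnNhd ℝ T U) (hU : IsPreconnected U) {e₀ e : E}
    (he₀ : e₀ ∈ U) (he : e ∈ U) {n : ℕ}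
    (hle : ∀ᶠ z in 𝓝 e₀, Module.finrank ℝ (T z).range ≤ n) :
    Module.finrank ℝ (T e).range ≤ n := by
  by_contra! hlt
  set R := (T e).range
  set N := Module.finrank ℝ R
  let b := Module.finBasis ℝ R
  choose u hu using fun i => (b i).2
  obtain ⟨Q, hQ⟩ : ∃ Q : Y →L[ℝ] R, ∀ k : R, Q k = k :=
    Submodule.ClosedComplemented.of_finiteDimensional R
  -- Coordinates dual to the vectors `T e (u j)`, which makes the minor `D` equal to 1 at `e`.
  let C : Fin N → Y →L[ℝ] ℝ := fun i => (LinearMap.toContinuousLinearMap (b.coord i)).comp Q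
  let D : E → ℝ := fun z => (Matrix.of fun i j => C i (T z (u j))).det
  have hD : AnalyticOnNhd ℝ D U := by
    intro z hz
    have h1 : ∀ i j, AnalyticAt ℝ (fun z => C i (T z (u j))) z := fun i j =>
      ((C i).comp (ContinuousLinearMap.apply ℝ Y (u j))).analyticAt _ |>.comp (hT z hz)
    simp only [D, Matrix.det_apply, Matrix.of_apply]
    refine Finset.analyticAt_fun_sum _ fun π _ => ?_
    simp only [Units.smul_def, zsmul_eq_mul]
    exact analyticAt_const.mul (Finset.analyticAt_fun_prod _ fun i _ => h1 _ _)
  have hD0 : D =ᶠ[𝓝 e₀] 0 := by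
    filter_upwards [hle] with z hz
    by_contra hne
    have hne : (Matrix.of fun i j => C i (T z (u j))).det ≠ 0 := hne
    let Cl : Y →ₗ[ℝ] (Fin N → ℝ) := LinearMap.pi fun i => (C i : Y →ₗ[ℝ] ℝ)
    have hli : LinearIndependent ℝ fun j => T z (u j) := by
      refine LinearIndependent.of_comp Cl ?_
      have := (Matrix.linearIndependent_cols_iff_isUnit (A := Matrix.of fun i j =>
        C i (T z (u j)))).2 ((Matrix.isUnit_iff_isUnit_det _).2 hne.isUnit)
      exact this
    have h2 : N ≤ Module.finrank ℝ (T z).range := by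
      have h3 : LinearIndependent ℝ fun j => (⟨T z (u j), ⟨u j, rfl⟩⟩ : (T z).range) :=
        LinearIndependent.of_comp (T z).range.subtype hli
      simpa using h3.fintype_card_le_finrank
    omega
  have h0 : D e = 0 := hD.eqOn_zero_of_preconnected_of_eventuallyEq_zero hU he₀ hD0 he
  have h1 : D e = 1 := by
    have : (Matrix.of fun i j => C i (T e (u j))) = 1 := by
      ext i j
      have hu' : T e (u j) = (b j : Y) := hu j
      simp only [Matrix.of_apply, C, ContinuousLinearMap.comp_apply, hu', hQ, Matrix.one_apply]
      simp [Finsupp.single_apply, eq_comm]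
    simp only [D, this, Matrix.det_one]
  exact zero_ne_one (h0.symm.trans h1)

end Rank

/-! ### Linear algebra of a dispersing beam. -/

section Beam

variable {F : Type*} [NormedAddCommGroup F] [InnerProductSpace ℝ F] [FiniteDimensional ℝ F]

/-- The linearization of a beam of parallel light under successive reflections: `Q j`, `Y j`, `M j`
and `τ j` are the variations of position, velocity, collision normal and flight time. -/
structure BeamVariation (L : ℕ → Submodule ℝ F) (r s : ℕ → ℝ) (V n : ℕ → F)
    (Q Y M : ℕ → F →L[ℝ] F) (τ : ℕ → F →L[ℝ] ℝ) (m : ℕ) : Prop where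
  pos_zero : ∀ ζ, Q 0 ζ = ζ
  vel_zero : ∀ ζ, Y 0 ζ = 0
  radius_pos : ∀ i < m, 0 < r i
  time_pos : ∀ i < m, 0 < s i
  normal_mem : ∀ i < m, n i ∈ L i
  norm_normal : ∀ i < m, ‖n i‖ = 1
  inner_neg : ∀ i < m, inner ℝ (V i) (n i) < 0
  vel_succ : ∀ i < m, V (i + 1) = V i - (2 * inner ℝ (V i) (n i)) • n i
  pos_var : ∀ i < m, ∀ ζ, Q (i + 1) ζ = Q i ζ + s i • Y i ζ + τ i ζ • V i
  normal_var : ∀ i < m, ∀ ζ, r i • M i ζ = (L i).starProjection (Q (i + 1) ζ)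
  inner_normal_var : ∀ i < m, ∀ ζ, inner ℝ (n i) (M i ζ) = 0
  inner_vel_var : ∀ i ≤ m, ∀ ζ, inner ℝ (V i) (Y i ζ) = 0
  vel_var : ∀ i < m, ∀ ζ, Y (i + 1) ζ = Y i ζ - (2 * inner ℝ (V i) (n i)) • M i ζ
    - (2 * (inner ℝ (Y i ζ) (n i) + inner ℝ (V i) (M i ζ))) • n i

namespace BeamVariation

variable {L : ℕ → Submodule ℝ F} {r s : ℕ → ℝ} {V n : ℕ → F}
  {Q Y M : ℕ → F →L[ℝ] F} {τ : ℕ → F →L[ℝ] ℝ} {m : ℕ}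

theorem inner_pos_var_of_mem (h : BeamVariation L r s V n Q Y M τ m) {i : ℕ} (hi : i < m) (ζ : F)
    {x : F} (hx : x ∈ L i) : inner ℝ (Q (i + 1) ζ) x = r i * inner ℝ (M i ζ) x := by
  rw [← real_inner_smul_left, h.normal_var i hi, Submodule.inner_starProjection_left_eq_right,
    Submodule.starProjection_eq_self_iff.2 hx]

theorem normal_var_mem (h : BeamVariation L r s V n Q Y M τ m) {i : ℕ} (hi : i < m) (ζ : F) :
    M i ζ ∈ L i := by
  have h1 : r i • M i ζ ∈ L i := by
    rw [h.normal_var i hi]; exact Submodule.starProjection_apply_mem _ _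
  exact ((L i).smul_mem_iff (h.radius_pos i hi).ne').1 h1

theorem inner_pos_var_normal (h : BeamVariation L r s V n Q Y M τ m) {i : ℕ} (hi : i < m) (ζ : F) :
    inner ℝ (Q (i + 1) ζ) (n i) = 0 := by
  rw [h.inner_pos_var_of_mem hi ζ (h.normal_mem i hi), real_inner_comm, h.inner_normal_var i hi,
    mul_zero]

theorem inner_vel_succ (h : BeamVariation L r s V n Q Y M τ m) {i : ℕ} (hi : i < m) :
    inner ℝ (V (i + 1)) (n i) = - inner ℝ (V i) (n i) := by
  rw [h.vel_succ i hi, inner_sub_left, real_inner_smul_left, real_inner_self_eq_norm_sq,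
    h.norm_normal i hi]
  ring

/-- The second fundamental form of the wave front, accumulated along the trajectory: one term for
each free flight and one for each collision. The remaining terms drop out because `V i` is
orthogonal to `Y i` and `Q (i + 1)` is orthogonal to `n i`. The result is symmetric, and its
coefficients are positive. -/
theorem inner_pos_vel (h : BeamVariation L r s V n Q Y M τ m) (ζ η : F) {j : ℕ} (hj : j ≤ m) :
    inner ℝ (Q j ζ) (Y j η) = ∑ i ∈ Finset.range j, (s i * inner ℝ (Y i ζ) (Y i η) +
      (-2 * inner ℝ (V i) (n i) * r i) * inner ℝ (M i ζ) (M i η)) := by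
  induction j with
  | zero => simp [h.vel_zero]
  | succ i ih =>
    have hi : i < m := hj
    rw [Finset.sum_range_succ, ← ih hi.le, h.vel_var i hi, inner_sub_right, inner_sub_right,
      real_inner_smul_right, real_inner_smul_right, h.inner_pos_var_normal hi,
      h.inner_pos_var_of_mem hi ζ (h.normal_var_mem hi η), h.pos_var i hi, inner_add_left,
      inner_add_left, real_inner_smul_left, real_inner_smul_left, h.inner_vel_var i hi.le]
    ring

theorem var_eq_zero (h : BeamVariation L r s V n Q Y M τ m) {ζ : F} {j : ℕ} (hj : j ≤ m)
    (h0 : inner ℝ (Q j ζ) (Y j ζ) = 0) : ∀ i < j, M i ζ = 0 ∧ Y i ζ = 0 := by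
  rw [h.inner_pos_vel ζ ζ hj] at h0
  have h1 : ∀ i ∈ Finset.range j, 0 ≤ s i * inner ℝ (Y i ζ) (Y i ζ) +
      (-2 * inner ℝ (V i) (n i) * r i) * inner ℝ (M i ζ) (M i ζ) ∧
      0 < s i ∧ 0 < -2 * inner ℝ (V i) (n i) * r i := by
    intro i hi
    have hi : i < m := (Finset.mem_range.1 hi).trans_le hj
    have a1 := h.time_pos i hi
    have a2 : 0 < -2 * inner ℝ (V i) (n i) * r i :=
      mul_pos (by have := h.inner_neg i hi; linarith) (h.radius_pos i hi)
    refine ⟨add_nonneg (mul_nonneg a1.le real_inner_self_nonneg)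
      (mul_nonneg a2.le real_inner_self_nonneg), a1, a2⟩
  rw [Finset.sum_eq_zero_iff_of_nonneg fun i hi => (h1 i hi).1] at h0
  intro i hi
  have hi := Finset.mem_range.2 hi
  obtain ⟨-, a1, a2⟩ := h1 i hi
  have h2 := h0 i hi
  rw [add_eq_zero_iff_of_nonneg (mul_nonneg a1.le real_inner_self_nonneg)
      (mul_nonneg a2.le real_inner_self_nonneg)] at h2
  exact ⟨inner_self_eq_zero.1 ((mul_eq_zero.1 h2.2).resolve_left a2.ne'),
    inner_self_eq_zero.1 ((mul_eq_zero.1 h2.1).resolve_left a1.ne')⟩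

/-- Descent through the collisions: pairing with the previous normal, to which `Q` is orthogonal and
the velocity is not, shows that the flight time does not vary. Only a shift along the initial
velocity remains. -/
theorem mem_span_of_pos_var_eq_zero (h : BeamVariation L r s V n Q Y M τ m) {ζ : F} {j : ℕ}
    (hj : j ≤ m) (hY : ∀ i < j, Y i ζ = 0) (h0 : Q j ζ = 0) : ζ ∈ Submodule.span ℝ {V 0} := by
  induction j with
  | zero => rw [← h.pos_zero ζ, h0]; exact zero_mem _
  | succ i ih =>
    have h1 := h.pos_var i hj ζ
    rw [h0, hY i (Nat.lt_succ_self i), smul_zero, add_zero] at h1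
    cases i with
    | zero =>
      rw [h.pos_zero] at h1
      rw [eq_neg_of_add_eq_zero_left h1.symm]
      exact neg_mem (Submodule.smul_mem _ _ (Submodule.mem_span_singleton_self _))
    | succ i =>
      have hi : i < m := by omega
      refine ih (by omega) (fun l hl => hY l (by omega)) ?_
      have h2 := congrArg (fun x => inner ℝ x (n i)) h1
      simp only [inner_add_left, h.inner_pos_var_normal hi, real_inner_smul_left,
        h.inner_vel_succ hi, inner_zero_left, zero_add] at h2
      have h3 := h.inner_neg i hi
      have h4 : τ (i + 1) ζ = 0 :=
        (mul_eq_zero.1 h2.symm).resolve_right (neg_ne_zero.2 h3.ne)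
      rw [h4, zero_smul, add_zero] at h1
      exact h1.symm

/-- The outgoing positions fill the tangent space of the scatterer. -/
theorem exists_pos_var_eq (h : BeamVariation L r s V n Q Y M τ m) {j : ℕ} (hj : j < m) {y : F}
    (hy : inner ℝ y (n j) = 0) : ∃ ζ, Q (j + 1) ζ = y := by
  have hn0 : n j ≠ 0 := by
    intro h0; have := h.norm_normal j hj; rw [h0, norm_zero] at this; exact zero_ne_one this
  set R := (Q (j + 1)).range with hR
  have hle : R ≤ (Submodule.span ℝ {n j})ᗮ := by
    rintro _ ⟨ζ, rfl⟩
    rw [Submodule.mem_orthogonal_singleton_iff_inner_left]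
    exact h.inner_pos_var_normal hj ζ
  have hker : (Q (j + 1)).ker ≤ Submodule.span ℝ {V 0} := by
    intro ζ hζ
    have hζ : Q (j + 1) ζ = 0 := hζ
    refine h.mem_span_of_pos_var_eq_zero hj (fun i hi => ?_) hζ
    exact (h.var_eq_zero hj (by rw [hζ, inner_zero_left]) i hi).2
  have d1 := LinearMap.finrank_range_add_finrank_ker ((Q (j + 1) : F →L[ℝ] F) : F →ₗ[ℝ] F)
  have d2 := (Submodule.finrank_mono hker).trans (finrank_span_le_card ({V 0} : Set F))
  have d3 := Submodule.finrank_add_finrank_orthogonal (Submodule.span ℝ {n j})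
  rw [finrank_span_singleton hn0] at d3
  -- The range lies in this hyperplane, and the kernel has dimension at most one.
  have heq : R = (Submodule.span ℝ {n j})ᗮ := by
    refine Submodule.eq_of_le_of_finrank_le hle ?_
    have : Module.finrank ℝ R = Module.finrank ℝ (LinearMap.range (Q (j + 1) : F →ₗ[ℝ] F)) := rfl
    simp only [Set.toFinset_singleton, Finset.card_singleton] at d2
    change _ ≤ 1 at d2
    change Module.finrank ℝ (Q (j + 1)).range + Module.finrank ℝ (Q (j + 1)).ker = _ at d1
    rw [hR]
    omega
  have : y ∈ R := by
    rw [heq, Submodule.mem_orthogonal_singleton_iff_inner_left]; exact hy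
  exact this

/-- Every infinitesimal rotation of the component of the outgoing velocity in the base subspace is
produced by a translation of the beam. -/
theorem exists_vel_var_eq (h : BeamVariation L r s V n Q Y M τ m) {j : ℕ} (hj : j < m) {y : F}
    (hyL : y ∈ L j) (hyV : inner ℝ (V (j + 1)) y = 0) : ∃ ζ, Y (j + 1) ζ = y := by
  set R := (Y (j + 1)).range with hR
  suffices hy : y ∈ Rᗮᗮ by
    rw [Submodule.orthogonal_orthogonal] at hy
    exact hy
  rw [Submodule.mem_orthogonal]
  intro x hx
  have hVn : inner ℝ (V (j + 1)) (n j) ≠ 0 := by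
    rw [h.inner_vel_succ hj]; exact neg_ne_zero.2 (h.inner_neg j hj).ne
  -- Subtracting a multiple of `V (j + 1)` makes `x` tangent to the scatterer and keeps it
  -- orthogonal to the range of `Y (j + 1)`.
  set c := inner ℝ x (n j) / inner ℝ (V (j + 1)) (n j) with hc
  obtain ⟨η, hη⟩ := h.exists_pos_var_eq hj (y := x - c • V (j + 1)) (by
    rw [inner_sub_left, real_inner_smul_left, hc, div_mul_cancel₀ _ hVn, sub_self])
  have h1 : inner ℝ (Q (j + 1) η) (Y (j + 1) η) = 0 := by
    rw [hη, inner_sub_left, real_inner_smul_left, h.inner_vel_var (j + 1) hj, mul_zero, sub_zero,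
      real_inner_comm]
    exact (Submodule.mem_orthogonal _ _).1 hx _ ⟨η, rfl⟩
  -- Vanishing of `M j η` means that `x - c • V (j + 1)` is orthogonal to `L j`.
  have h2 := (h.var_eq_zero hj h1 j (Nat.lt_succ_self j)).1
  have h3 := h.inner_pos_var_of_mem hj η hyL
  rw [h2, inner_zero_left, mul_zero, hη, inner_sub_left, real_inner_smul_left, hyV, mul_zero,
    sub_zero] at h3
  exact h3

end BeamVariation

end Beam

/-! ### A single collision with a cylinder. -/

section Collision

theorem norm_sub_two_inner_smul {F : Type*} [NormedAddCommGroup F] [InnerProductSpace ℝ F]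
    {v n : F} (hn : ‖n‖ = 1) :
    ‖v - (2 * inner ℝ v n) • n‖ = ‖v‖ := by
  rw [← sq_eq_sq₀ (norm_nonneg _) (norm_nonneg _), norm_sub_sq_real, norm_smul, mul_pow, hn,
    real_inner_smul_right, Real.norm_eq_abs, sq_abs]
  ring

variable {F : Type*} [NormedAddCommGroup F] [InnerProductSpace ℝ F] [FiniteDimensional ℝ F]

/-- The discriminant of the quadratic equation for the time at which the point with position `z.1`
and velocity `z.2` reaches the boundary of the cylinder `{x | ‖P_L x - c‖ < r}`. -/
def hitDiscr (L : Submodule ℝ F) (c : F) (r : ℝ) (z : F × F) : ℝ :=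
  inner ℝ (L.starProjection z.1 - c) (L.starProjection z.2) ^ 2 -
    ‖L.starProjection z.2‖ ^ 2 * (‖L.starProjection z.1 - c‖ ^ 2 - r ^ 2)

/-- The time at which the point with position `z.1` and velocity `z.2` enters the cylinder. -/
def hitTime (L : Submodule ℝ F) (c : F) (r : ℝ) (z : F × F) : ℝ :=
  (- inner ℝ (L.starProjection z.1 - c) (L.starProjection z.2) - √(hitDiscr L c r z)) /
    ‖L.starProjection z.2‖ ^ 2

/-- The place of the collision. -/
def hitPos (L : Submodule ℝ F) (c : F) (r : ℝ) (z : F × F) : F :=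
  z.1 + hitTime L c r z • z.2

/-- The outer unit normal vector of the cylinder at the place of the collision. -/
def hitNormal (L : Submodule ℝ F) (c : F) (r : ℝ) (z : F × F) : F :=
  r⁻¹ • (L.starProjection (hitPos L c r z) - c)

/-- Position and velocity immediately after the specular reflection at the cylinder. -/
def collide (L : Submodule ℝ F) (c : F) (r : ℝ) (z : F × F) : F × F :=
  (hitPos L c r z, z.2 - (2 * inner ℝ z.2 (hitNormal L c r z)) • hitNormal L c r z)

/-- The point with position `z.1` and velocity `z.2` hits the cylinder transversally in the
future. -/
structure Hits (L : Submodule ℝ F) (c : F) (r : ℝ) (z : F × F) : Prop where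
  proj_ne_zero : L.starProjection z.2 ≠ 0
  discr_pos : 0 < hitDiscr L c r z
  time_pos : 0 < hitTime L c r z

section

variable {L : Submodule ℝ F} {c : F} {r : ℝ} {z : F × F}

theorem contDiff_hitDiscr : ContDiff ℝ 1 (hitDiscr L c r) := by
  have h1 : ContDiff ℝ 1 fun z : F × F => L.starProjection z.1 - c :=
    (L.starProjection.contDiff.comp contDiff_fst).sub contDiff_const
  have h2 : ContDiff ℝ 1 fun z : F × F => L.starProjection z.2 :=
    L.starProjection.contDiff.comp contDiff_snd
  exact ((h1.inner ℝ h2).pow 2).sub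
    ((h2.norm_sq ℝ).mul ((h1.norm_sq ℝ).sub contDiff_const))

theorem contDiffAt_hitTime (h : Hits L c r z) : ContDiffAt ℝ 1 (hitTime L c r) z := by
  have h1 : ContDiff ℝ 1 fun z : F × F => L.starProjection z.1 - c :=
    (L.starProjection.contDiff.comp contDiff_fst).sub contDiff_const
  have h2 : ContDiff ℝ 1 fun z : F × F => L.starProjection z.2 :=
    L.starProjection.contDiff.comp contDiff_snd
  refine ContDiffAt.div (((h1.inner ℝ h2).neg.contDiffAt).sub
    (contDiff_hitDiscr.contDiffAt.sqrt h.discr_pos.ne')) (h2.norm_sq ℝ).contDiffAt ?_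
  exact pow_ne_zero 2 (norm_ne_zero_iff.2 h.proj_ne_zero)

theorem contDiffAt_hitPos (h : Hits L c r z) : ContDiffAt ℝ 1 (hitPos L c r) z :=
  contDiffAt_fst.add ((contDiffAt_hitTime h).smul contDiffAt_snd)

theorem contDiffAt_hitNormal (h : Hits L c r z) : ContDiffAt ℝ 1 (hitNormal L c r) z :=
  contDiffAt_const.smul
    ((L.starProjection.contDiff.contDiffAt.comp z (contDiffAt_hitPos h)).sub contDiffAt_const)

theorem contDiffAt_collide (h : Hits L c r z) : ContDiffAt ℝ 1 (collide L c r) z :=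
  (contDiffAt_hitPos h).prodMk (contDiffAt_snd.sub
    ((contDiffAt_const.mul (contDiffAt_snd.inner ℝ (contDiffAt_hitNormal h))).smul
      (contDiffAt_hitNormal h)))

theorem Hits.eventually (h : Hits L c r z) : ∀ᶠ z' in 𝓝 z, Hits L c r z' := by
  have h1 : ContinuousAt (fun z : F × F => L.starProjection z.2) z := by fun_prop
  filter_upwards [h1.eventually_ne h.proj_ne_zero,
    contDiff_hitDiscr.continuous.continuousAt.eventually (lt_mem_nhds h.discr_pos),
    (contDiffAt_hitTime h).continuousAt.eventually (lt_mem_nhds h.time_pos)] with z' a1 a2 a3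
  exact ⟨a1, a2, a3⟩

theorem smul_hitNormal (hr : r ≠ 0) :
    r • hitNormal L c r z = L.starProjection (hitPos L c r z) - c := smul_inv_smul₀ hr _

theorem hitNormal_mem (hc : c ∈ L) : hitNormal L c r z ∈ L :=
  L.smul_mem _ (L.sub_mem (Submodule.starProjection_apply_mem _ _) hc)

theorem inner_starProjection_of_mem {L : Submodule ℝ F} {n : F} (hn : n ∈ L) (x : F) :
    inner ℝ (L.starProjection x) n = inner ℝ x n := by
  rw [Submodule.inner_starProjection_left_eq_right, Submodule.starProjection_eq_self_iff.2 hn]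

theorem proj_hitPos_sub : L.starProjection (hitPos L c r z) - c =
    (L.starProjection z.1 - c) + hitTime L c r z • L.starProjection z.2 := by
  rw [hitPos, map_add, map_smul]; abel

theorem Hits.norm_hitNormal (h : Hits L c r z) (hr : 0 < r) : ‖hitNormal L c r z‖ = 1 := by
  have hw : ‖L.starProjection z.2‖ ^ 2 ≠ 0 := pow_ne_zero 2 (norm_ne_zero_iff.2 h.proj_ne_zero)
  have h1 : ‖L.starProjection (hitPos L c r z) - c‖ ^ 2 = r ^ 2 := by
    rw [proj_hitPos_sub, norm_add_sq_real, norm_smul, mul_pow, Real.norm_eq_abs, sq_abs,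
      real_inner_smul_right]
    have h2 : hitTime L c r z * ‖L.starProjection z.2‖ ^ 2 =
        - inner ℝ (L.starProjection z.1 - c) (L.starProjection z.2) - √(hitDiscr L c r z) :=
      div_mul_cancel₀ _ hw
    have h3 : √(hitDiscr L c r z) ^ 2 = _ := Real.sq_sqrt h.discr_pos.le
    rw [hitDiscr] at h3
    rw [hitDiscr] at h2
    refine mul_right_cancel₀ hw ?_
    generalize √_ = R at h2 h3
    generalize inner ℝ (L.starProjection z.1 - c) (L.starProjection z.2) = b at *
    generalize ‖L.starProjection z.2‖ ^ 2 = W at *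
    generalize hitTime L c r z = t at *
    have : R = - b - t * W := by linarith
    rw [this] at h3
    linear_combination h3
  rw [hitNormal, norm_smul, norm_inv, Real.norm_of_nonneg hr.le]
  rw [pow_left_inj₀ (norm_nonneg _) hr.le two_ne_zero] at h1
  rw [h1, inv_mul_cancel₀ hr.ne']

theorem Hits.inner_hitNormal_neg (h : Hits L c r z) (hr : 0 < r) (hc : c ∈ L) :
    inner ℝ z.2 (hitNormal L c r z) < 0 := by
  have hw : ‖L.starProjection z.2‖ ^ 2 ≠ 0 := pow_ne_zero 2 (norm_ne_zero_iff.2 h.proj_ne_zero)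
  rw [← inner_starProjection_of_mem (hitNormal_mem hc), hitNormal, proj_hitPos_sub,
    real_inner_smul_right, inner_add_right, real_inner_smul_right, real_inner_self_eq_norm_sq,
    hitTime, div_mul_cancel₀ _ hw, real_inner_comm]
  have := Real.sqrt_pos.2 h.discr_pos
  have := inv_pos.2 hr
  nlinarith

theorem Hits.norm_collide (h : Hits L c r z) (hr : 0 < r) : ‖(collide L c r z).2‖ = ‖z.2‖ :=
  norm_sub_two_inner_smul (h.norm_hitNormal hr)

/-- A collision recognized from its time and its normal vector. -/
theorem hits_of_eq {t : ℝ} {n : F} (hr : 0 < r) (ht : 0 < t) (hnL : n ∈ L) (hn : ‖n‖ = 1)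
    (hneg : inner ℝ z.2 n < 0)
    (heq : L.starProjection (z.1 + t • z.2) - c = r • n) :
    Hits L c r z ∧ hitTime L c r z = t ∧ hitNormal L c r z = n := by
  have hw : L.starProjection z.2 ≠ 0 := by
    intro h0
    rw [← inner_starProjection_of_mem hnL, h0, inner_zero_left] at hneg
    exact lt_irrefl _ hneg
  have hw2 : ‖L.starProjection z.2‖ ^ 2 ≠ 0 := pow_ne_zero 2 (norm_ne_zero_iff.2 hw)
  have hu : L.starProjection z.1 - c = r • n - t • L.starProjection z.2 := by
    rw [← heq, map_add, map_smul]; abel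
  have hb : inner ℝ n (L.starProjection z.2) = inner ℝ z.2 n := by
    rw [real_inner_comm, inner_starProjection_of_mem hnL]
  -- The discriminant is a perfect square; the sign of `⟨z.2, n⟩` makes `t` the entrance time and
  -- not the exit time.
  have hd : hitDiscr L c r z = (- (r * inner ℝ z.2 n)) ^ 2 := by
    rw [hitDiscr, hu, inner_sub_left, real_inner_smul_left, real_inner_smul_left,
      real_inner_self_eq_norm_sq, norm_sub_sq_real, norm_smul, norm_smul, hn,
      real_inner_smul_left, real_inner_smul_right, hb, mul_pow, mul_pow, Real.norm_eq_abs,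
      Real.norm_eq_abs, sq_abs, sq_abs]
    ring
  have hpos : 0 < - (r * inner ℝ z.2 n) := by
    have := mul_neg_of_pos_of_neg hr hneg; linarith
  have htime : hitTime L c r z = t := by
    rw [hitTime, hd, Real.sqrt_sq hpos.le, hu, inner_sub_left, real_inner_smul_left,
      real_inner_smul_left, real_inner_self_eq_norm_sq, hb, div_eq_iff hw2]
    ring
  refine ⟨⟨hw, ?_, htime ▸ ht⟩, htime, ?_⟩
  · rw [hd]; positivity
  · rw [hitNormal, hitPos, htime, heq, inv_smul_smul₀ hr.ne']

/-- A change of speed rescales time and keeps the places of collision. Ranks are studied on an open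
set of states, with all speeds, while paths have unit speed. -/
theorem collide_smul {a : ℝ} (ha : 0 < a) (z : F × F) :
    collide L c r (z.1, a • z.2) = ((collide L c r z).1, a • (collide L c r z).2) ∧
      (Hits L c r z → Hits L c r (z.1, a • z.2)) := by
  have hd : hitDiscr L c r (z.1, a • z.2) = a ^ 2 * hitDiscr L c r z := by
    simp only [hitDiscr, map_smul, norm_smul, real_inner_smul_right, mul_pow, Real.norm_eq_abs,
      sq_abs]
    ring
  have ht : hitTime L c r (z.1, a • z.2) = a⁻¹ * hitTime L c r z := by
    rw [hitTime, hd, Real.sqrt_mul (sq_nonneg a), Real.sqrt_sq ha.le, hitTime]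
    simp only [map_smul, norm_smul, real_inner_smul_right, mul_pow, Real.norm_eq_abs, sq_abs]
    rw [show -(a * inner ℝ (L.starProjection z.1 - c) (L.starProjection z.2)) -
      a * √(hitDiscr L c r z) = a * (-inner ℝ (L.starProjection z.1 - c) (L.starProjection z.2) -
      √(hitDiscr L c r z)) by ring, sq a, mul_assoc a a, mul_div_mul_left _ _ ha.ne', ← div_div,
      div_right_comm]
    field_simp
  have hp : hitPos L c r (z.1, a • z.2) = hitPos L c r z := by
    simp only [hitPos, ht, smul_smul]
    rw [mul_right_comm, inv_mul_cancel₀ ha.ne', one_mul]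
  have hn : hitNormal L c r (z.1, a • z.2) = hitNormal L c r z := by
    simp only [hitNormal, hp]
  refine ⟨Prod.ext hp ?_, fun h => ⟨?_, ?_, ?_⟩⟩
  · simp only [collide, hn, real_inner_smul_left, smul_sub, smul_smul]
    congr 2; ring
  · simpa only [map_smul] using smul_ne_zero ha.ne' h.proj_ne_zero
  · rw [hd]; exact mul_pos (pow_pos ha 2) h.discr_pos
  · rw [ht]; exact mul_pos (inv_pos.2 ha) h.time_pos

end

/-! ### Successive collisions and their derivatives. -/

section Flow

variable (L : ℕ → Submodule ℝ F) (c : ℕ → F) (r : ℕ → ℝ)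

/-- Position and velocity after the collisions with the first `j` cylinders. -/
def cylFlow : ℕ → F × F → F × F
  | 0, z => z
  | j + 1, z => collide (L j) (c j) (r j) (cylFlow j z)

/-- The initial state `z` leads to collisions with the first `m` cylinders in succession. -/
def HitsAll (m : ℕ) (z : F × F) : Prop :=
  ∀ j < m, Hits (L j) (c j) (r j) (cylFlow L c r j z)

/-- The flight time before the `j`-th collision. -/
def flightTime (j : ℕ) (z : F × F) : ℝ :=
  hitTime (L j) (c j) (r j) (cylFlow L c r j z)

/-- The normal vector at the `j`-th collision. -/
def flowNormal (j : ℕ) (z : F × F) : F :=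
  hitNormal (L j) (c j) (r j) (cylFlow L c r j z)

variable {L c r} {m : ℕ} {z : F × F}

theorem HitsAll.contDiffAt_cylFlow (h : HitsAll L c r m z) {j : ℕ} (hj : j ≤ m) :
    ContDiffAt ℝ 1 (cylFlow L c r j) z := by
  induction j with
  | zero => exact contDiffAt_id
  | succ j ih => exact (contDiffAt_collide (h j hj)).comp z (ih (Nat.le_of_succ_le hj))

theorem HitsAll.contDiffAt_flightTime (h : HitsAll L c r m z) {j : ℕ} (hj : j < m) :
    ContDiffAt ℝ 1 (flightTime L c r j) z :=
  (contDiffAt_hitTime (h j hj)).comp z (h.contDiffAt_cylFlow hj.le)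

theorem HitsAll.contDiffAt_flowNormal (h : HitsAll L c r m z) {j : ℕ} (hj : j < m) :
    ContDiffAt ℝ 1 (flowNormal L c r j) z :=
  (contDiffAt_hitNormal (h j hj)).comp z (h.contDiffAt_cylFlow hj.le)

theorem HitsAll.eventually (h : HitsAll L c r m z) : ∀ᶠ z' in 𝓝 z, HitsAll L c r m z' := by
  have : ∀ j ∈ Set.Iio m, ∀ᶠ z' in 𝓝 z, Hits (L j) (c j) (r j) (cylFlow L c r j z') :=
    fun j hj => (h.contDiffAt_cylFlow (le_of_lt hj)).continuousAt.eventually (h j hj).eventually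
  exact (eventually_all_finite (Set.finite_Iio m)).2 this

theorem isOpen_setOf_hitsAll : IsOpen {z | HitsAll L c r m z} :=
  isOpen_iff_mem_nhds.2 fun _ h => HitsAll.eventually h

theorem HitsAll.norm_vel (h : HitsAll L c r m z) (hr : ∀ j < m, 0 < r j) {j : ℕ} (hj : j ≤ m) :
    ‖(cylFlow L c r j z).2‖ = ‖z.2‖ := by
  induction j with
  | zero => rfl
  | succ j ih => exact ((h j hj).norm_collide (hr j hj)).trans (ih (Nat.le_of_succ_le hj))

theorem cylFlow_smul {a : ℝ} (ha : 0 < a) (z : F × F) (j : ℕ) :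
    cylFlow L c r j (z.1, a • z.2) = ((cylFlow L c r j z).1, a • (cylFlow L c r j z).2) := by
  induction j with
  | zero => rfl
  | succ j ih => simp only [cylFlow, ih, (collide_smul ha _).1]

theorem HitsAll.smul (h : HitsAll L c r m z) {a : ℝ} (ha : 0 < a) :
    HitsAll L c r m (z.1, a • z.2) := fun j hj => by
  rw [cylFlow_smul ha]; exact (collide_smul ha _).2 (h j hj)

/-- The derivative of the `j`-th velocity with respect to the initial position. -/
def velVar (L : ℕ → Submodule ℝ F) (c : ℕ → F) (r : ℕ → ℝ) (j : ℕ) (z : F × F) : F →L[ℝ] F :=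
  (fderiv ℝ (fun z => (cylFlow L c r j z).2) z).comp (ContinuousLinearMap.inl ℝ F F)

/-- Each clause on variations differentiates an identity of the flow in the direction `(ζ, 0)`; the
orthogonality relations come from unit normals and conservation of speed. -/
theorem HitsAll.beamVariation (h : HitsAll L c r m z) (hr : ∀ j < m, 0 < r j)
    (hc : ∀ j < m, c j ∈ L j) :
    BeamVariation L r (fun j => flightTime L c r j z) (fun j => (cylFlow L c r j z).2)
      (fun j => flowNormal L c r j z)
      (fun j => (fderiv ℝ (fun z => (cylFlow L c r j z).1) z).comp
        (ContinuousLinearMap.inl ℝ F F))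
      (fun j => velVar L c r j z)
      (fun j => (fderiv ℝ (flowNormal L c r j) z).comp (ContinuousLinearMap.inl ℝ F F))
      (fun j => (fderiv ℝ (flightTime L c r j) z).comp (ContinuousLinearMap.inl ℝ F F)) m := by
  have dQ : ∀ j ≤ m, DifferentiableAt ℝ (fun z => (cylFlow L c r j z).1) z := fun j hj =>
    ((h.contDiffAt_cylFlow hj).fst).differentiableAt one_ne_zero
  have dV : ∀ j ≤ m, DifferentiableAt ℝ (fun z => (cylFlow L c r j z).2) z := fun j hj =>
    ((h.contDiffAt_cylFlow hj).snd).differentiableAt one_ne_zero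
  have dn : ∀ j < m, DifferentiableAt ℝ (flowNormal L c r j) z := fun j hj =>
    (h.contDiffAt_flowNormal hj).differentiableAt one_ne_zero
  have dt : ∀ j < m, DifferentiableAt ℝ (flightTime L c r j) z := fun j hj =>
    (h.contDiffAt_flightTime hj).differentiableAt one_ne_zero
  refine ⟨fun ζ => ?_, fun ζ => ?_, hr, fun i hi => (h i hi).time_pos,
    fun i hi => hitNormal_mem (hc i hi), fun i hi => (h i hi).norm_hitNormal (hr i hi),
    fun i hi => (h i hi).inner_hitNormal_neg (hr i hi) (hc i hi), fun i _ => rfl,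
    fun i hi ζ => ?_, fun i hi ζ => ?_, fun i hi ζ => ?_, fun i hi ζ => ?_, fun i hi ζ => ?_⟩
  · have : HasFDerivAt (fun z => (cylFlow L c r 0 z).1) (ContinuousLinearMap.fst ℝ F F) z :=
      hasFDerivAt_fst
    simp [this.fderiv]
  · have : HasFDerivAt (fun z => (cylFlow L c r 0 z).2) (ContinuousLinearMap.snd ℝ F F) z :=
      hasFDerivAt_snd
    simp [velVar, this.fderiv]
  · have : HasFDerivAt (fun z => (cylFlow L c r (i + 1) z).1) _ z :=
      (dQ i hi.le).hasFDerivAt.add ((dt i hi).hasFDerivAt.smul (dV i hi.le).hasFDerivAt)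
    simp [velVar, this.fderiv, add_assoc]
  · have h1 : HasFDerivAt (fun z => r i • flowNormal L c r i z) _ z :=
      (dn i hi).hasFDerivAt.const_smul (r i)
    have h2 : HasFDerivAt (fun z => (L i).starProjection (cylFlow L c r (i + 1) z).1 - c i) _ z :=
      ((L i).starProjection.hasFDerivAt.comp z (dQ (i + 1) hi).hasFDerivAt).sub_const (c i)
    have h3 : (fun z => r i • flowNormal L c r i z) =
        fun z => (L i).starProjection (cylFlow L c r (i + 1) z).1 - c i :=
      funext fun z => smul_hitNormal (hr i hi).ne'
    rw [h3] at h1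
    simpa using congrArg (fun T : F × F →L[ℝ] F => T (ζ, 0)) (h1.unique h2)
  · have h1 : HasFDerivAt (fun z => inner ℝ (flowNormal L c r i z) (flowNormal L c r i z)) _ z :=
      (dn i hi).hasFDerivAt.inner ℝ (dn i hi).hasFDerivAt
    have h2 : (fun z => inner ℝ (flowNormal L c r i z) (flowNormal L c r i z)) =ᶠ[𝓝 z]
        fun _ => (1 : ℝ) := by
      filter_upwards [h.eventually] with z' hz'
      rw [real_inner_self_eq_norm_sq, flowNormal, (hz' i hi).norm_hitNormal (hr i hi), one_pow]
    have h3 := (h1.congr_of_eventuallyEq h2.symm).unique (hasFDerivAt_const (1 : ℝ) z)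
    have h4 := congrArg (fun T : F × F →L[ℝ] ℝ => T (ζ, 0)) h3
    simp [real_inner_comm (flowNormal L c r i z)] at h4
    simpa using h4
  · have h1 : HasFDerivAt (fun z => inner ℝ (cylFlow L c r i z).2 (cylFlow L c r i z).2) _ z :=
      (dV i hi).hasFDerivAt.inner ℝ (dV i hi).hasFDerivAt
    have h2 : (fun z => inner ℝ (cylFlow L c r i z).2 (cylFlow L c r i z).2) =ᶠ[𝓝 z]
        fun z => inner ℝ z.2 z.2 := by
      filter_upwards [h.eventually] with z' hz'
      rw [real_inner_self_eq_norm_sq, real_inner_self_eq_norm_sq, hz'.norm_vel hr hi]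
    have h5 : HasFDerivAt (fun z : F × F => inner ℝ z.2 z.2) _ z :=
      (hasFDerivAt_snd (𝕜 := ℝ) (p := z)).inner ℝ (hasFDerivAt_snd (𝕜 := ℝ) (p := z))
    have h3 := (h1.congr_of_eventuallyEq h2.symm).unique h5
    have h4 := congrArg (fun T : F × F →L[ℝ] ℝ => T (ζ, 0)) h3
    simp [real_inner_comm (cylFlow L c r i z).2] at h4
    simpa [velVar] using h4
  · have h1 : HasFDerivAt (fun z => (cylFlow L c r (i + 1) z).2) _ z :=
      (dV i hi.le).hasFDerivAt.sub
        ((((dV i hi.le).hasFDerivAt.inner ℝ (dn i hi).hasFDerivAt).const_mul 2).smul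
          (dn i hi).hasFDerivAt)
    simp only [velVar, h1.fderiv]
    simp [real_inner_comm]
    rw [sub_sub, add_comm (inner ℝ _ _)]
    rfl

end Flow

end Collision

/-! ### Constant rank in the first variable, and recovery of a vector from its components. -/

section Factor

variable {F : Type*} [NormedAddCommGroup F] [InnerProductSpace ℝ F] [FiniteDimensional ℝ F]

/-- A map `g` whose partial derivative in the first variable has constant rank near `p` is, near
`p`, a function of the second variable and of the projection of `g` to the range `W` of this
derivative. -/
theorem exists_factor_of_finrank_const {g : F × F → F} {p : F × F} (hg : ContDiffAt ℝ 1 g p)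
    {W : Submodule ℝ F}
    (hW : W = ((fderiv ℝ g p).comp (ContinuousLinearMap.inl ℝ F F)).range)
    (hconst : ∀ᶠ z in 𝓝 p, Module.finrank ℝ
      ((fderiv ℝ g z).comp (ContinuousLinearMap.inl ℝ F F)).range = Module.finrank ℝ W) :
    ∃ ψ : F × W → F, ContDiffAt ℝ 1 ψ (p.2, W.orthogonalProjectionOnto (g p)) ∧
      ∀ᶠ z in 𝓝 p, g z = ψ (z.2, W.orthogonalProjectionOnto (g z)) := by
  set π : F →L[ℝ] W := W.orthogonalProjectionOnto
  -- A submersion at `p`: moving the first variable alone already makes `π ∘ g` cover `W`.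
  let f : F × F → F × W := fun z => (z.2, π (g z))
  have hf : ContDiffAt ℝ 1 f p := contDiffAt_snd.prodMk (π.contDiff.contDiffAt.comp p hg)
  have hf' : ∀ z, DifferentiableAt ℝ g z →
      ∀ u, fderiv ℝ f z u = (u.2, π (fderiv ℝ g z u)) := by
    intro z hz u
    have : HasFDerivAt f _ z :=
      hasFDerivAt_snd.prodMk (π.hasFDerivAt.comp z hz.hasFDerivAt)
    rw [this.fderiv]; rfl
  have hπ : ∀ w ∈ W, ((π w : W) : F) = w := fun w hw =>
    Submodule.starProjection_eq_self_iff.2 hw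
  have hdp := hg.differentiableAt one_ne_zero
  refine exists_factor_of_ker_le_ker hf hg ?_ ?_
  · rintro ⟨v, w⟩
    have hmem : ((w - π (fderiv ℝ g p (0, v)) : W) : F) ∈ W := Subtype.mem _
    obtain ⟨ζ, hζ⟩ := hW.le hmem
    have hζ : fderiv ℝ g p (ζ, 0) = ((w - π (fderiv ℝ g p (0, v)) : W) : F) := hζ
    refine ⟨(ζ, v), ?_⟩
    rw [hf' p hdp]
    refine Prod.ext rfl ?_
    have h1 : ((ζ, v) : F × F) = (ζ, 0) + (0, v) := by simp
    have h2 : π ((w - π (fderiv ℝ g p (0, v)) : W) : F) = w - π (fderiv ℝ g p (0, v)) :=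
      Subtype.ext (hπ _ hmem)
    show π (fderiv ℝ g p (ζ, v)) = w
    rw [h1, map_add, hζ, map_add, h2]
    abel
  · have hc : ContinuousAt (fun z => π.comp
        ((fderiv ℝ g z).comp (ContinuousLinearMap.inl ℝ F F))) p :=
      continuousAt_const.clm_comp
        ((hg.continuousAt_fderiv one_ne_zero).clm_comp continuousAt_const)
    have htop : (π.comp ((fderiv ℝ g p).comp (ContinuousLinearMap.inl ℝ F F))).range = ⊤ := by
      rw [eq_top_iff]
      rintro w -
      obtain ⟨ζ, hζ⟩ := hW.le w.2
      refine ⟨ζ, Subtype.ext ?_⟩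
      show ((π ((fderiv ℝ g p).comp (ContinuousLinearMap.inl ℝ F F) ζ) : W) : F) = w
      have hζ : ((fderiv ℝ g p).comp (ContinuousLinearMap.inl ℝ F F)) ζ = (w : F) := hζ
      rw [hζ, hπ _ w.2]
    filter_upwards [hconst, eventually_finrank_range_le hc, hg.eventually (by simp)]
      with z h1 h2 h3 u hu
    rw [htop, finrank_top] at h2
    have hdz := h3.differentiableAt one_ne_zero
    rw [hf' z hdz, Prod.mk_eq_zero] at hu
    obtain ⟨hu1, hu2⟩ := hu
    set D : F →L[ℝ] F := (fderiv ℝ g z).comp (ContinuousLinearMap.inl ℝ F F) with hD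
    have hDu : fderiv ℝ g z u = D u.1 := by
      rw [hD, ContinuousLinearMap.comp_apply, ContinuousLinearMap.inl_apply, ← hu1]
    rw [hDu] at hu2 ⊢
    -- The range of `D` has the dimension of `W` and projects onto `W`, so the projection is
    -- injective on it.
    let ρ : D.range →ₗ[ℝ] W := (π : F →ₗ[ℝ] W).domRestrict D.range
    have hρ : (π.comp D).range ≤ LinearMap.range ρ := by
      rintro _ ⟨ζ, rfl⟩
      exact ⟨⟨D ζ, ⟨ζ, rfl⟩⟩, rfl⟩
    have h4 := Submodule.finrank_mono hρ
    have h5 := LinearMap.finrank_range_add_finrank_ker ρ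
    have h6 : LinearMap.ker ρ = ⊥ := by
      rw [← Submodule.finrank_eq_zero (R := ℝ)]
      omega
    have h7 : (⟨D u.1, ⟨u.1, rfl⟩⟩ : D.range) ∈ LinearMap.ker ρ := hu2
    rw [h6, Submodule.mem_bot] at h7
    exact congrArg Subtype.val h7

/-- Two vectors with equal norms and equal components orthogonal to `v₀ = P_L w` coincide if they
lie on the same side of `v₀`. -/
theorem eq_of_proj_eq {L : Submodule ℝ F} {x y w : F} (hK : x - y ∈ L)
    (hT : ∀ t ∈ L, inner ℝ t w = 0 → inner ℝ t (x - y) = 0) (hn : ‖x‖ = ‖y‖)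
    (hx : 0 < inner ℝ x (L.starProjection w)) (hy : 0 < inner ℝ y (L.starProjection w)) :
    x = y := by
  set v := L.starProjection w with hv
  have hvL : v ∈ L := Submodule.starProjection_apply_mem _ _
  have hv0 : ‖v‖ ^ 2 ≠ 0 := by
    refine pow_ne_zero 2 (norm_ne_zero_iff.2 fun h0 => ?_)
    rw [h0, inner_zero_right] at hx; exact lt_irrefl _ hx
  set a := inner ℝ (x - y) v / ‖v‖ ^ 2 with ha
  have htL : (x - y) - a • v ∈ L := L.sub_mem hK (L.smul_mem _ hvL)
  have htv : inner ℝ ((x - y) - a • v) v = 0 := by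
    rw [inner_sub_left, real_inner_smul_left, real_inner_self_eq_norm_sq, ha,
      div_mul_cancel₀ _ hv0, sub_self]
  have htw : inner ℝ ((x - y) - a • v) w = 0 := by
    rw [← htv, hv, ← Submodule.inner_starProjection_left_eq_right,
      Submodule.starProjection_eq_self_iff.2 htL]
  have h1 := hT _ htL htw
  have h2 : (x - y) - a • v = 0 := by
    rw [← inner_self_eq_zero (𝕜 := ℝ)]
    rw [inner_sub_right ((x - y) - a • v), h1, real_inner_smul_right, htv, mul_zero, sub_zero]
  -- Now `x - y = a • v`, and equal norms give `a * ⟨x + y, v⟩ = 0` with a positive second factor.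
  have h3 : inner ℝ (x + y) (x - y) = 0 := (real_inner_add_sub_eq_zero_iff x y).2 hn
  rw [sub_eq_zero.1 h2, real_inner_smul_right, inner_add_left] at h3
  have h4 : a = 0 := (mul_eq_zero.1 h3).resolve_right (by linarith)
  rw [h4, zero_smul, sub_zero] at h2
  exact sub_eq_zero.1 h2

end Factor

/-! ### Velocity histories with free normals. -/

section History

variable {F : Type*} [NormedAddCommGroup F] [InnerProductSpace ℝ F] [FiniteDimensional ℝ F]

/-- The velocity history with initial velocity `e.1` that is obtained by reflections in the
directions of the projections of the vectors `e.2 i` to the base subspaces. -/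
def velHist (L : ℕ → Submodule ℝ F) (m : ℕ) : ℕ → F × (Fin m → F) → F
  | 0, e => e.1
  | j + 1, e =>
    if h : j < m then
      velHist L m j e - (2 * inner ℝ (velHist L m j e) ((L j).starProjection (e.2 ⟨j, h⟩)) /
        ‖(L j).starProjection (e.2 ⟨j, h⟩)‖ ^ 2) • (L j).starProjection (e.2 ⟨j, h⟩)
    else velHist L m j e

/-- The initial velocity and the collision normals of the beam at `z`. -/
def normalHist (L : ℕ → Submodule ℝ F) (c : ℕ → F) (r : ℕ → ℝ) (m : ℕ) (z : F × F) :
    F × (Fin m → F) :=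
  (z.2, fun i => flowNormal L c r i z)

/-- The vectors `e.2 i` determine directions in the base subspaces. -/
def histDomain (L : ℕ → Submodule ℝ F) (m : ℕ) : Set (F × (Fin m → F)) :=
  {e | ∀ i : Fin m, (L i).starProjection (e.2 i) ≠ 0}

variable {L : ℕ → Submodule ℝ F} {c : ℕ → F} {r : ℕ → ℝ} {m : ℕ} {z : F × F}

theorem velHist_succ {j : ℕ} (hj : j < m) (e : F × (Fin m → F)) :
    velHist L m (j + 1) e = velHist L m j e -
      (2 * inner ℝ (velHist L m j e) ((L j).starProjection (e.2 ⟨j, hj⟩)) /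
        ‖(L j).starProjection (e.2 ⟨j, hj⟩)‖ ^ 2) • (L j).starProjection (e.2 ⟨j, hj⟩) := by
  rw [velHist, dif_pos hj]

theorem isOpen_histDomain : IsOpen (histDomain L m) := by
  simp only [histDomain, Set.ofPred_forall]
  refine isOpen_iInter_of_finite fun i => isOpen_ne.preimage (f := fun e : F × (Fin m → F) =>
    (L i).starProjection (e.2 i)) (by fun_prop)

/-- Each factor is the complement of `(L i)ᗮ`, whose codimension is `dim L i`; from codimension two
on, removing a subspace does not disconnect. -/
theorem isPreconnected_histDomain (hL : ∀ j < m, 2 ≤ Module.finrank ℝ (L j)) :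
    IsPreconnected (histDomain L m) := by
  have h1 : histDomain L m =
      Set.univ ×ˢ Set.pi Set.univ (fun i : Fin m => (((L i)ᗮ : Submodule ℝ F) : Set F)ᶜ) := by
    ext e
    simp [histDomain, Submodule.starProjection_apply_eq_zero_iff]
  rw [h1]
  refine isPreconnected_univ.prod (isPreconnected_univ_pi fun i => ?_)
  refine (isConnected_compl_of_one_lt_codim ?_).isPreconnected
  have h2 := Submodule.finrank_quotient_add_finrank ((L i)ᗮ : Submodule ℝ F)
  have h3 := Submodule.finrank_add_finrank_orthogonal (L i)
  have h4 := hL i i.2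
  rw [← Module.finrank_eq_rank]
  exact_mod_cast (by omega : 1 < Module.finrank ℝ (F ⧸ (L i)ᗮ))

theorem analyticOnNhd_velHist {j : ℕ} (hj : j ≤ m) :
    AnalyticOnNhd ℝ (velHist L m j) (histDomain L m) := by
  induction j with
  | zero => exact fun e _ => analyticAt_fst
  | succ j ih =>
    have hj' : j < m := hj
    intro e he
    have h1 := ih hj'.le e he
    let l : F × (Fin m → F) →L[ℝ] F := (L j).starProjection.comp
      ((ContinuousLinearMap.proj ⟨j, hj'⟩).comp (ContinuousLinearMap.snd ℝ F (Fin m → F)))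
    have h2 : AnalyticAt ℝ l e := l.analyticAt e
    have hinner : ∀ {u v : F × (Fin m → F) → F}, AnalyticAt ℝ u e → AnalyticAt ℝ v e →
        AnalyticAt ℝ (fun e => inner ℝ (u e) (v e)) e := fun {u v} hu hv =>
      (((innerSL ℝ).comp (ContinuousLinearMap.id ℝ F)).analyticAt_bilinear (u e, v e)).comp₂ hu hv
    have h3 : velHist L m (j + 1) = fun e => velHist L m j e -
        (2 * inner ℝ (velHist L m j e) (l e) / inner ℝ (l e) (l e)) • l e := by
      funext e
      rw [velHist_succ hj', real_inner_self_eq_norm_sq]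
      rfl
    rw [h3]
    refine h1.sub (((analyticAt_const.mul (hinner h1 h2)).div (hinner h2 h2) ?_).smul h2)
    exact inner_self_ne_zero.2 (he ⟨j, hj'⟩)

theorem velHist_succ_sub_mem {j : ℕ} (hj : j < m) (e : F × (Fin m → F)) :
    velHist L m (j + 1) e - velHist L m j e ∈ L j := by
  rw [velHist_succ hj, sub_sub_cancel_left]
  exact neg_mem ((L j).smul_mem _ (Submodule.starProjection_apply_mem _ _))

theorem norm_velHist {j : ℕ} (hj : j ≤ m) (e : F × (Fin m → F)) :
    ‖velHist L m j e‖ = ‖e.1‖ := by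
  induction j with
  | zero => rfl
  | succ j ih =>
    rw [← ih (Nat.le_of_succ_le hj), velHist_succ hj]
    set n := (L j).starProjection (e.2 ⟨j, hj⟩)
    by_cases hn : n = 0
    · rw [hn, smul_zero, sub_zero]
    · have h1 : ‖(‖n‖⁻¹ • n)‖ = 1 := by
        rw [norm_smul, norm_inv, norm_norm, inv_mul_cancel₀ (norm_ne_zero_iff.2 hn)]
      rw [← norm_sub_two_inner_smul (v := velHist L m j e) h1, real_inner_smul_right, smul_smul]
      congr 3
      field_simp

theorem HitsAll.normalHist_mem (h : HitsAll L c r m z) (hr : ∀ j < m, 0 < r j)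
    (hc : ∀ j < m, c j ∈ L j) : normalHist L c r m z ∈ histDomain L m := by
  intro i h0
  have h1 : flowNormal L c r i z ∈ L i := hitNormal_mem (hc i i.2)
  have h2 : ‖flowNormal L c r i z‖ = 1 := (h i i.2).norm_hitNormal (hr i i.2)
  rw [show (normalHist L c r m z).2 i = flowNormal L c r i z from rfl,
    Submodule.starProjection_eq_self_iff.2 h1] at h0
  rw [h0, norm_zero] at h2
  exact zero_ne_one h2

theorem HitsAll.velHist_normalHist (h : HitsAll L c r m z) (hr : ∀ j < m, 0 < r j)
    (hc : ∀ j < m, c j ∈ L j) {j : ℕ} (hj : j ≤ m) :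
    velHist L m j (normalHist L c r m z) = (cylFlow L c r j z).2 := by
  induction j with
  | zero => rfl
  | succ j ih =>
    have h1 : flowNormal L c r j z ∈ L j := hitNormal_mem (hc j hj)
    have h2 : ‖flowNormal L c r j z‖ = 1 := (h j hj).norm_hitNormal (hr j hj)
    rw [velHist_succ hj, ih (Nat.le_of_succ_le hj)]
    simp only [normalHist]
    rw [Submodule.starProjection_eq_self_iff.2 h1, h2, one_pow, div_one]
    rfl

end History

/-! ### Comparison of beams with free histories. -/

section Comparison

variable {F : Type*} [NormedAddCommGroup F] [InnerProductSpace ℝ F] [FiniteDimensional ℝ F]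
  {L : ℕ → Submodule ℝ F} {c : ℕ → F} {r : ℕ → ℝ} {m : ℕ} {z : F × F}

/-- The velocity histories near the one of `z` have the same initial and `j`-th velocities as
points near `z`. -/
def HistoriesRealized (L : ℕ → Submodule ℝ F) (c : ℕ → F) (r : ℕ → ℝ) (m j : ℕ) (z : F × F) :
    Prop :=
  ∀ U ∈ 𝓝 z, ∀ᶠ e in 𝓝 (normalHist L c r m z),
    ∃ z' ∈ U, z'.2 = e.1 ∧ (cylFlow L c r j z').2 = velHist L m j e

/-- The derivative with respect to the initial position of the component of the `j`-th velocity
orthogonal to the `j`-th base subspace. -/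
def orthVelVar (L : ℕ → Submodule ℝ F) (c : ℕ → F) (r : ℕ → ℝ) (j : ℕ) (z : F × F) : F →L[ℝ] F :=
  (L j)ᗮ.starProjection.comp (velVar L c r j z)

theorem historiesRealized_zero : HistoriesRealized L c r m 0 z := by
  intro U hU
  have h1 : Tendsto (fun e : F × (Fin m → F) => (z.1, e.1)) (𝓝 (normalHist L c r m z)) (𝓝 z) :=
    (continuous_const.prodMk continuous_fst).tendsto' _ _ rfl
  filter_upwards [h1 hU] with e he
  exact ⟨_, he, rfl, rfl⟩

theorem sub_mem_of_orth_eq {L : Submodule ℝ F} {x y : F}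
    (h : Lᗮ.starProjection x = Lᗮ.starProjection y) : x - y ∈ L := by
  have h1 : Lᗮ.starProjection (x - y) = 0 := by rw [map_sub, h, sub_self]
  rw [Submodule.starProjection_apply_eq_zero_iff, Submodule.orthogonal_orthogonal] at h1
  exact h1

theorem orth_eq_of_sub_mem {L : Submodule ℝ F} {x y : F} (h : x - y ∈ L) :
    Lᗮ.starProjection x = Lᗮ.starProjection y := by
  rw [← sub_eq_zero, ← map_sub, Submodule.starProjection_apply_eq_zero_iff,
    Submodule.orthogonal_orthogonal]
  exact h

theorem cylFlow_succ_sub_mem {j : ℕ} (hc : c j ∈ L j) (z : F × F) :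
    (cylFlow L c r (j + 1) z).2 - (cylFlow L c r j z).2 ∈ L j := by
  show _ - _ • hitNormal (L j) (c j) (r j) (cylFlow L c r j z) - _ ∈ L j
  rw [sub_sub_cancel_left]
  exact neg_mem ((L j).smul_mem _ (hitNormal_mem hc))

theorem HitsAll.fderiv_orth (h : HitsAll L c r m z) {j : ℕ} (hj : j ≤ m) :
    (fderiv ℝ (fun z => (L j)ᗮ.starProjection (cylFlow L c r j z).2) z).comp
      (ContinuousLinearMap.inl ℝ F F) = orthVelVar L c r j z := by
  have h1 : HasFDerivAt (fun z => (L j)ᗮ.starProjection (cylFlow L c r j z).2) _ z :=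
    (L j)ᗮ.starProjection.hasFDerivAt.comp z
      (((h.contDiffAt_cylFlow hj).snd).differentiableAt one_ne_zero).hasFDerivAt
  rw [h1.fderiv]
  rfl

/-- The velocity `V (j + 1)` is recovered from its norm, its component orthogonal to `L j`, its
component in `T` and a choice of side. By constant rank the orthogonal component is a function `ψ`
of the initial velocity and of coordinates in `W`. The remaining free data form the submersion `Θ`,
so all values near `Θ z` are attained near `z`. -/
theorem HitsAll.historiesRealized_succ (h : HitsAll L c r m z) (hr : ∀ j < m, 0 < r j)
    (hc : ∀ j < m, c j ∈ L j) {j : ℕ} (hj : j < m)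
    (hconst : ∀ᶠ z' in 𝓝 z, Module.finrank ℝ (orthVelVar L c r j z').range =
      Module.finrank ℝ (orthVelVar L c r j z).range)
    (ih : HistoriesRealized L c r m j z) : HistoriesRealized L c r m (j + 1) z := by
  intro U hU
  have hbeam := h.beamVariation hr hc
  let V : ℕ → F × F → F := fun i z => (cylFlow L c r i z).2
  have cV : ∀ i ≤ m, ContDiffAt ℝ 1 (V i) z := fun i hi => (h.contDiffAt_cylFlow hi).snd
  let K : F →L[ℝ] F := (L j)ᗮ.starProjection
  let g : F × F → F := fun z => K (V j z)
  have cg : ContDiffAt ℝ 1 g z := K.contDiff.contDiffAt.comp z (cV j hj.le)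
  set W : Submodule ℝ F := ((fderiv ℝ g z).comp (ContinuousLinearMap.inl ℝ F F)).range with hW
  have hWeq : W = (orthVelVar L c r j z).range := by rw [hW, ← h.fderiv_orth hj.le]
  obtain ⟨ψ, -, hψ⟩ := exists_factor_of_finrank_const cg hW (by
    filter_upwards [hconst, h.eventually] with z' h1 h2
    rw [hWeq, ← h1, ← h2.fderiv_orth hj.le])
  set π : F →L[ℝ] W := W.orthogonalProjectionOnto
  -- The infinitesimal rotations of the `L j`-component of `V (j + 1) z`.
  let T : Submodule ℝ F := L j ⊓ (Submodule.span ℝ {V (j + 1) z})ᗮ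
  let πT : F →L[ℝ] T := T.orthogonalProjectionOnto
  have hT : ∀ t : F, t ∈ T ↔ t ∈ L j ∧ inner ℝ t (V (j + 1) z) = 0 := fun t => by
    simp only [T, Submodule.mem_inf, Submodule.mem_orthogonal_singleton_iff_inner_left]
  have hKV : ∀ z', K (V (j + 1) z') = K (V j z') := fun z' =>
    orth_eq_of_sub_mem (cylFlow_succ_sub_mem (hc j hj) z')
  let Θ : F × F → (F × W) × T := fun z => ((z.2, π (g z)), πT (V (j + 1) z))
  have dg := (cg.hasStrictFDerivAt one_ne_zero)
  have dV := ((cV (j + 1) hj).hasStrictFDerivAt one_ne_zero)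
  have dΘ : HasStrictFDerivAt Θ (((ContinuousLinearMap.snd ℝ F F).prod
      (π.comp (fderiv ℝ g z))).prod (πT.comp (fderiv ℝ (V (j + 1)) z))) z :=
    (hasStrictFDerivAt_snd.prodMk (π.hasStrictFDerivAt.comp z dg)).prodMk
      (πT.hasStrictFDerivAt.comp z dV)
  -- The shift `ζ` adjusts the `W`-component. Then `η` corrects the `T`-component; it changes `V (j
  -- + 1)` only inside `L j` and so leaves `g` alone.
  have hsurj : (((ContinuousLinearMap.snd ℝ F F).prod
      (π.comp (fderiv ℝ g z))).prod (πT.comp (fderiv ℝ (V (j + 1)) z))).range = ⊤ := by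
    rw [eq_top_iff]
    rintro ⟨⟨v, w⟩, t⟩ -
    obtain ⟨ζ, hζ⟩ := hW.le (w - π (fderiv ℝ g z (0, v))).2
    have hζ : fderiv ℝ g z (ζ, 0) = ((w - π (fderiv ℝ g z (0, v)) : W) : F) := hζ
    set t' : T := t - πT (fderiv ℝ (V (j + 1)) z (ζ, v)) with ht'
    have ht'' := (hT t').1 t'.2
    obtain ⟨η, hη⟩ := hbeam.exists_vel_var_eq hj ht''.1 (by rw [real_inner_comm]; exact ht''.2)
    have hη : fderiv ℝ (V (j + 1)) z (η, 0) = (t' : F) := hη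
    have hgη : fderiv ℝ g z (η, 0) = 0 := by
      have e1 : g = fun z => K (V (j + 1) z) := funext fun z' => (hKV z').symm
      have e2 : HasFDerivAt g (K.comp (fderiv ℝ (V (j + 1)) z)) z := by
        rw [e1]; exact K.hasFDerivAt.comp z dV.hasFDerivAt
      rw [e2.fderiv]
      show K (fderiv ℝ (V (j + 1)) z (η, 0)) = 0
      rw [hη, ← map_zero K]
      exact orth_eq_of_sub_mem (by rw [sub_zero]; exact ht''.1)
    have e1 : ((ζ + η, v) : F × F) = (ζ, 0) + (0, v) + (η, 0) := by simp
    have e2 : ((ζ + η, v) : F × F) = (ζ, v) + (η, 0) := by simp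
    refine ⟨(ζ + η, v), Prod.ext (Prod.ext rfl ?_) ?_⟩
    · show π (fderiv ℝ g z (ζ + η, v)) = w
      rw [e1, map_add, hgη, add_zero, map_add, hζ, map_add]
      have : π ((w - π (fderiv ℝ g z (0, v)) : W) : F) = w - π (fderiv ℝ g z (0, v)) :=
        Subtype.ext (Submodule.starProjection_eq_self_iff.2 (Subtype.mem _))
      rw [this]; abel
    · show πT (fderiv ℝ (V (j + 1)) z (ζ + η, v)) = t
      rw [e2, map_add, hη, map_add]
      have : πT (t' : F) = t' :=
        Subtype.ext (Submodule.starProjection_eq_self_iff.2 (Subtype.mem _))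
      rw [this, ht']; abel
  have hmap := dΘ.map_nhds_eq_of_surj hsurj
  set v₀ := (L j).starProjection (V (j + 1) z) with hv₀
  have hpos : 0 < inner ℝ (V (j + 1) z) v₀ := by
    rw [hv₀, ← Submodule.starProjection_eq_self_iff.2
      (Submodule.starProjection_apply_mem (L j) (V (j + 1) z)),
      ← Submodule.inner_starProjection_left_eq_right, real_inner_self_eq_norm_sq]
    refine pow_pos (norm_pos_iff.2 fun h0 => ?_) 2
    have h1 := hbeam.inner_vel_succ hj
    rw [← inner_starProjection_of_mem (hbeam.normal_mem j hj)] at h1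
    have h2 := hbeam.inner_neg j hj
    rw [show (L j).starProjection (cylFlow L c r (j + 1) z).2 = 0 from h0, inner_zero_left] at h1
    linarith
  have hU' : ∀ᶠ z' in 𝓝 z, z' ∈ U ∧ HitsAll L c r m z' ∧ g z' = ψ (z'.2, π (g z')) ∧
      0 < inner ℝ (V (j + 1) z') v₀ := by
    filter_upwards [hU, h.eventually, hψ,
      (((cV (j + 1) hj).continuousAt).inner (𝕜 := ℝ) continuousAt_const).eventually
        (lt_mem_nhds hpos)] with z' h1 h2 h3 h4
    exact ⟨h1, h2, h3, h4⟩
  have hmem := h.normalHist_mem hr hc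
  have hE : ContinuousAt (velHist L m (j + 1)) (normalHist L c r m z) :=
    (analyticOnNhd_velHist hj _ hmem).continuousAt
  have hEz : velHist L m (j + 1) (normalHist L c r m z) = V (j + 1) z :=
    h.velHist_normalHist hr hc hj
  have hKE : ∀ e, K (velHist L m (j + 1) e) = K (velHist L m j e) := fun e =>
    orth_eq_of_sub_mem (velHist_succ_sub_mem hj e)
  let Ξ : F × (Fin m → F) → (F × W) × T := fun e =>
    ((e.1, π (K (velHist L m (j + 1) e))), πT (velHist L m (j + 1) e))
  have hΞ : Tendsto Ξ (𝓝 (normalHist L c r m z)) (𝓝 (Θ z)) := by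
    have h1 : ContinuousAt Ξ (normalHist L c r m z) :=
      (continuousAt_fst.prodMk (π.continuous.continuousAt.comp
        (K.continuous.continuousAt.comp hE))).prodMk (πT.continuous.continuousAt.comp hE)
    have h2 : Ξ (normalHist L c r m z) = Θ z := by
      show ((z.2, π (K (velHist L m (j + 1) (normalHist L c r m z)))),
        πT (velHist L m (j + 1) (normalHist L c r m z))) = Θ z
      rw [hEz, hKV]
    rw [← h2]
    exact h1
  have himg : ∀ᶠ y in 𝓝 (Θ z), ∃ z', (z' ∈ U ∧ HitsAll L c r m z' ∧
      g z' = ψ (z'.2, π (g z')) ∧ 0 < inner ℝ (V (j + 1) z') v₀) ∧ Θ z' = y := by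
    rw [← hmap, eventually_map]
    exact hU'.mono fun z' hz' => ⟨z', hz', rfl⟩
  have hEpos : ∀ᶠ e in 𝓝 (normalHist L c r m z), 0 < inner ℝ (velHist L m (j + 1) e) v₀ :=
    (hE.inner (𝕜 := ℝ) continuousAt_const).eventually (lt_mem_nhds (by
      show 0 < inner ℝ (velHist L m (j + 1) (normalHist L c r m z)) v₀
      rw [hEz]; exact hpos))
  -- Two different trajectories serve `e`: `y`, from the induction, shows that the history satisfies
  -- the relation `ψ`; `z'` has the same `Θ`-data as the history. Both orthogonal components are
  -- then the value of `ψ` at the same argument.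
  filter_upwards [hΞ.eventually himg, hEpos, ih _ hψ] with e h1 h2 ⟨y, hy, hy1, hy2⟩
  obtain ⟨z', ⟨hzU, hzH, hzψ, hzpos⟩, hzΘ⟩ := h1
  have a1 : z'.2 = e.1 := congrArg (fun y => y.1.1) hzΘ
  have a2 : π (g z') = π (K (velHist L m (j + 1) e)) := congrArg (fun y => y.1.2) hzΘ
  have a3 : πT (V (j + 1) z') = πT (velHist L m (j + 1) e) := congrArg (fun y => y.2) hzΘ
  refine ⟨z', hzU, a1, ?_⟩
  have a4 : K (V (j + 1) z') = K (velHist L m (j + 1) e) := by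
    have hy : g y = ψ (y.2, π (g y)) := hy
    have b1 : g y = K (velHist L m (j + 1) e) := by
      rw [hKE, ← hy2]
    rw [b1, hy1] at hy
    rw [hKV]
    show g z' = _
    rw [hzψ, a1, a2, ← hy]
  refine eq_of_proj_eq (L := L j) (w := V (j + 1) z) (sub_mem_of_orth_eq a4)
    (fun t htL htV => ?_) ?_ hzpos h2
  · have htT : t ∈ T := (hT t).2 ⟨htL, htV⟩
    have b1 : T.starProjection (V (j + 1) z' - velHist L m (j + 1) e) = 0 := by
      rw [map_sub, sub_eq_zero]; exact congrArg Subtype.val a3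
    show inner ℝ t (V (j + 1) z' - velHist L m (j + 1) e) = 0
    rw [real_inner_comm, ← inner_starProjection_of_mem htT, b1, inner_zero_left]
  · rw [hzH.norm_vel hr hj, norm_velHist hj, a1]

/-- The rank of the final velocity as a function of the normal vectors is bounded by the rank of the
beam at `z`, if the ranks at `z` are locally constant. -/
theorem HitsAll.eventually_finrank_le (h : HitsAll L c r m z) (hr : ∀ j < m, 0 < r j)
    (hc : ∀ j < m, c j ∈ L j)
    (hconst : ∀ j < m, ∀ᶠ z' in 𝓝 z, Module.finrank ℝ (orthVelVar L c r j z').range =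
      Module.finrank ℝ (orthVelVar L c r j z).range)
    (hconst' : ∀ᶠ z' in 𝓝 z, Module.finrank ℝ (velVar L c r m z').range =
      Module.finrank ℝ (velVar L c r m z).range) :
    ∀ᶠ e in 𝓝 (normalHist L c r m z), Module.finrank ℝ ((fderiv ℝ (velHist L m m) e).comp
      (ContinuousLinearMap.inr ℝ F (Fin m → F))).range ≤
        Module.finrank ℝ (velVar L c r m z).range := by
  have hreal : ∀ j ≤ m, HistoriesRealized L c r m j z := by
    intro j hj
    induction j with
    | zero => exact historiesRealized_zero
    | succ j ih => exact h.historiesRealized_succ hr hc hj (hconst j hj) (ih (Nat.le_of_succ_le hj))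
  set W : Submodule ℝ F := (velVar L c r m z).range with hW
  obtain ⟨ψ, hψc, hψ⟩ := exists_factor_of_finrank_const (g := fun z => (cylFlow L c r m z).2)
    (h.contDiffAt_cylFlow le_rfl).snd hW hconst'
  set π : F →L[ℝ] W := W.orthogonalProjectionOnto
  have hmem := h.normalHist_mem hr hc
  -- A free history shares its first and last velocities with a trajectory, so it inherits the
  -- relation `ψ`.
  have hfac : ∀ᶠ e in 𝓝 (normalHist L c r m z),
      velHist L m m e = ψ (e.1, π (velHist L m m e)) := by
    filter_upwards [hreal m le_rfl _ hψ] with e ⟨z', hz', h1, h2⟩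
    rw [← h1, ← h2]
    exact hz'
  have hE := (analyticOnNhd_velHist (L := L) le_rfl _ hmem).continuousAt
  have hcont : ContinuousAt (fun e => (e.1, π (velHist L m m e))) (normalHist L c r m z) :=
    continuousAt_fst.prodMk (π.continuous.continuousAt.comp hE)
  have hψd : ∀ᶠ e in 𝓝 (normalHist L c r m z), ContDiffAt ℝ 1 ψ (e.1, π (velHist L m m e)) := by
    refine hcont.eventually ?_
    show ∀ᶠ y in 𝓝 ((normalHist L c r m z).1, π (velHist L m m (normalHist L c r m z))), _
    rw [h.velHist_normalHist hr hc le_rfl]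
    exact hψc.eventually (by simp)
  filter_upwards [hfac.eventually_nhds, hψd, isOpen_histDomain.mem_nhds hmem] with e h1 h2 h3
  have d1 := (analyticOnNhd_velHist (L := L) le_rfl e h3).differentiableAt.hasFDerivAt
  have d2 : HasFDerivAt (fun e => ψ (e.1, π (velHist L m m e))) _ e :=
    (h2.differentiableAt one_ne_zero).hasFDerivAt.comp e
      (hasFDerivAt_fst.prodMk (π.hasFDerivAt.comp e d1))
  have d3 := d1.unique (d2.congr_of_eventuallyEq h1)
  -- With `e.1` fixed, the derivative of `velHist` factors through `W`.
  set A : W →L[ℝ] F := (fderiv ℝ ψ (e.1, π (velHist L m m e))).comp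
    (ContinuousLinearMap.inr ℝ F W)
  have hle : ((fderiv ℝ (velHist L m m) e).comp
      (ContinuousLinearMap.inr ℝ F (Fin m → F))).range ≤ A.range := by
    rintro _ ⟨η, rfl⟩
    refine ⟨π (fderiv ℝ (velHist L m m) e (0, η)), ?_⟩
    exact (congrArg (fun B : F × (Fin m → F) →L[ℝ] F => B (0, η)) d3).symm
  exact (Submodule.finrank_mono hle).trans (LinearMap.finrank_range_le (A : W →ₗ[ℝ] F))

/-- The rank of a beam is bounded by the rank of the final velocity as a function of the normal
vectors. -/
theorem HitsAll.finrank_velVar_le (h : HitsAll L c r m z) (hr : ∀ j < m, 0 < r j)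
    (hc : ∀ j < m, c j ∈ L j) :
    Module.finrank ℝ (velVar L c r m z).range ≤
      Module.finrank ℝ ((fderiv ℝ (velHist L m m) (normalHist L c r m z)).comp
        (ContinuousLinearMap.inr ℝ F (Fin m → F))).range := by
  have d1 := (analyticOnNhd_velHist (L := L) le_rfl _
    (h.normalHist_mem hr hc)).differentiableAt.hasFDerivAt
  have dn : DifferentiableAt ℝ (fun (z : F × F) (i : Fin m) => flowNormal L c r i z) z :=
    (contDiffAt_pi.2 fun i : Fin m => h.contDiffAt_flowNormal i.2).differentiableAt one_ne_zero
  have d2 : HasFDerivAt (normalHist L c r m) _ z := hasFDerivAt_snd.prodMk dn.hasFDerivAt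
  have d3 := d1.comp z d2
  have hev : (fun z => (cylFlow L c r m z).2) =ᶠ[𝓝 z] velHist L m m ∘ normalHist L c r m := by
    filter_upwards [h.eventually] with z' hz'
    exact (hz'.velHist_normalHist hr hc le_rfl).symm
  refine Submodule.finrank_mono ?_
  rintro _ ⟨ζ, rfl⟩
  refine ⟨fderiv ℝ (fun (z : F × F) (i : Fin m) => flowNormal L c r i z) z (ζ, 0), ?_⟩
  show _ = fderiv ℝ (fun z => (cylFlow L c r m z).2) z (ζ, 0)
  rw [(d3.congr_of_eventuallyEq hev).fderiv]
  rfl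

theorem HitsAll.continuousAt_velVar (h : HitsAll L c r m z) {j : ℕ} (hj : j ≤ m) :
    ContinuousAt (velVar L c r j) z :=
  ((h.contDiffAt_cylFlow hj).snd.continuousAt_fderiv one_ne_zero).clm_comp continuousAt_const

theorem HitsAll.finrank_velVar_smul (h : HitsAll L c r m z) {a : ℝ} (ha : 0 < a) :
    Module.finrank ℝ (velVar L c r m z).range ≤
      Module.finrank ℝ (velVar L c r m (z.1, a • z.2)).range := by
  have d0 := ((h.smul ha).contDiffAt_cylFlow le_rfl).snd.differentiableAt one_ne_zero
  let S : F × F →L[ℝ] F × F :=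
    (ContinuousLinearMap.fst ℝ F F).prod (a • ContinuousLinearMap.snd ℝ F F)
  have d1 : HasFDerivAt (fun z => (cylFlow L c r m (S z)).2) _ z :=
    HasFDerivAt.comp (g := fun z => (cylFlow L c r m z).2) z d0.hasFDerivAt S.hasFDerivAt
  have d2 : HasFDerivAt (fun z => a • (cylFlow L c r m z).2) _ z :=
    ((h.contDiffAt_cylFlow le_rfl).snd.differentiableAt one_ne_zero).hasFDerivAt.const_smul a
  have heq : (fun z => (cylFlow L c r m (S z)).2) = fun z => a • (cylFlow L c r m z).2 :=
    funext fun z => congrArg Prod.snd (cylFlow_smul ha z m)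
  rw [heq] at d1
  have d3 := d1.unique d2
  refine Submodule.finrank_mono ?_
  rintro _ ⟨ζ, rfl⟩
  refine ⟨a⁻¹ • ζ, ?_⟩
  have h1 : fderiv ℝ (fun z => (cylFlow L c r m z).2) (z.1, a • z.2) (ζ, 0) =
      a • fderiv ℝ (fun z => (cylFlow L c r m z).2) z (ζ, 0) := by
    have := congrArg (fun B : F × F →L[ℝ] F => B (ζ, 0)) d3
    simpa [S] using this
  show velVar L c r m (z.1, a • z.2) (a⁻¹ • ζ) = velVar L c r m z ζ
  rw [map_smul]
  show a⁻¹ • fderiv ℝ (fun z => (cylFlow L c r m z).2) (z.1, a • z.2) (ζ, 0) = _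
  rw [h1, inv_smul_smul₀ ha.ne']
  rfl

/-- The maximal rank of the beams does not depend on the positions of the cylinders. -/
theorem exists_finrank_velVar_le (hL : ∀ j < m, 2 ≤ Module.finrank ℝ (L j))
    (hr : ∀ j < m, 0 < r j) {c c' : ℕ → F} (hc : ∀ j < m, c j ∈ L j) (hc' : ∀ j < m, c' j ∈ L j)
    {z z' : F × F} (h : HitsAll L c r m z) (hz : z.2 ≠ 0) (h' : HitsAll L c' r m z') :
    ∃ y, HitsAll L c r m y ∧ ‖y.2‖ = 1 ∧
      Module.finrank ℝ (velVar L c' r m z').range ≤ Module.finrank ℝ (velVar L c r m y).range := by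
  -- For `m = 0` hitting all cylinders does not exclude zero velocity, which could not be
  -- normalized.
  have hU : IsOpen {y : F × F | HitsAll L c r m y ∧ y.2 ≠ 0} :=
    isOpen_setOf_hitsAll.inter (isOpen_ne.preimage continuous_snd)
  -- All the ranks to be made locally constant at once: `none` stands for the final velocity.
  let D : Option (Fin m) → F × F → F →L[ℝ] F := fun i =>
    i.elim (velVar L c r m) fun j => orthVelVar L c r j
  obtain ⟨y, ⟨hy, hy0⟩, hconst⟩ := exists_eventually_const hU ⟨z, h, hz⟩
    (ρ := fun i y => Module.finrank ℝ (D i y).range) (fun i y => Submodule.finrank_le _) (by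
      rintro i y ⟨hy, -⟩
      refine eventually_finrank_range_le ?_
      cases i with
      | none => exact hy.continuousAt_velVar le_rfl
      | some j => exact continuousAt_const.clm_comp (hy.continuousAt_velVar j.2.le))
  have hle := hy.eventually_finrank_le hr hc (fun j hj => hconst (some ⟨j, hj⟩)) (hconst none)
  have han : AnalyticOnNhd ℝ (fun e => (fderiv ℝ (velHist L m m) e).comp
      (ContinuousLinearMap.inr ℝ F (Fin m → F))) (histDomain L m) := fun e he =>
    ((ContinuousLinearMap.compL ℝ (Fin m → F) (F × (Fin m → F)) F).flip
      (ContinuousLinearMap.inr ℝ F (Fin m → F))).analyticAt _ |>.comp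
      ((analyticOnNhd_velHist (L := L) le_rfl).fderiv e he)
  -- The centres change here: the bound near the normals of `y` is continued to the normals of `z'`.
  have h1 := finrank_range_le_of_eventually_le han (isPreconnected_histDomain hL)
    (hy.normalHist_mem hr hc) (h'.normalHist_mem hr hc') hle
  have ha : 0 < ‖y.2‖⁻¹ := inv_pos.2 (norm_pos_iff.2 hy0)
  refine ⟨(y.1, ‖y.2‖⁻¹ • y.2), hy.smul ha, ?_,
    ((h'.finrank_velVar_le hr hc').trans h1).trans (hy.finrank_velVar_smul ha)⟩
  rw [norm_smul, norm_inv, norm_norm, inv_mul_cancel₀ (norm_ne_zero_iff.2 hy0)]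

end Comparison

/-! ### Polygonal curves with prescribed velocities. -/

section PiecewiseLinear

variable {F : Type*} [NormedAddCommGroup F] [NormedSpace ℝ F] {m : ℕ}

/-- The continuous piecewise linear curve with velocities `v 0, …, v m` and break points `t j`. -/
def polygonalCurve (t : Fin m → ℝ≥0) (v : Fin (m + 1) → F) (s : ℝ≥0) : F :=
  (s : ℝ) • v 0 + ∑ i : Fin m, max ((s : ℝ) - t i) 0 • (v i.succ - v i.castSucc)

theorem sum_ite_castSucc_lt {F : Type*} [AddCommGroup F] {m : ℕ} (v : Fin (m + 1) → F) (j : Fin (m + 1)) :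
    ∑ i : Fin m, (if i.castSucc < j then v i.succ - v i.castSucc else 0) = v j - v 0 := by
  induction j using Fin.induction with
  | zero => simp
  | succ j ih =>
    have h1 : ∀ i : Fin m, (if i.castSucc < j.succ then v i.succ - v i.castSucc else 0) =
        (if i.castSucc < j.castSucc then v i.succ - v i.castSucc else 0) +
          (if i = j then v i.succ - v i.castSucc else 0) := by
      intro i
      rcases lt_trichotomy i j with h | h | h
      · have h2 : i.castSucc < j.castSucc := h
        have h3 : i.castSucc < j.succ := h2.trans Fin.castSucc_lt_succ
        simp [h2, h3, h.ne]
      · subst h; simp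
      · have h2 : ¬ i.castSucc < j.castSucc := not_lt.2 (show j.castSucc ≤ i.castSucc from h.le)
        have h3 : ¬ i.castSucc < j.succ := by
          rw [Fin.lt_def] at h ⊢
          simp only [Fin.val_castSucc, Fin.val_succ]
          omega
        simp [h2, h3, h.ne']
    rw [Finset.sum_congr rfl fun i _ => h1 i, Finset.sum_add_distrib, ih]
    simp

theorem polygonalCurve_sub {t : Fin m → ℝ≥0} (v : Fin (m + 1) → F) {j : Fin (m + 1)} {s s' : ℝ≥0}
    (hs : s ∈ timeSegment t j) (hs' : s' ∈ timeSegment t j) :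
    polygonalCurve t v s' - polygonalCurve t v s = ((s' : ℝ) - s) • v j := by
  have h1 : ∀ i : Fin m, max ((s' : ℝ) - t i) 0 • (v i.succ - v i.castSucc) -
      max ((s : ℝ) - t i) 0 • (v i.succ - v i.castSucc) =
      ((s' : ℝ) - s) • (if i.castSucc < j then v i.succ - v i.castSucc else 0) := by
    intro i
    split_ifs with h
    · rw [max_eq_left (sub_nonneg.2 (NNReal.coe_le_coe.2 (hs.1 i h))),
        max_eq_left (sub_nonneg.2 (NNReal.coe_le_coe.2 (hs'.1 i h))), ← sub_smul]
      congr 1; ring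
    · rw [max_eq_right (sub_nonpos.2 (NNReal.coe_le_coe.2 (hs.2 i (not_lt.1 h)))),
        max_eq_right (sub_nonpos.2 (NNReal.coe_le_coe.2 (hs'.2 i (not_lt.1 h))))]
      simp
  rw [polygonalCurve, polygonalCurve, add_sub_add_comm, ← Finset.sum_sub_distrib,
    Finset.sum_congr rfl fun i _ => h1 i, ← Finset.smul_sum, sum_ite_castSucc_lt, ← sub_smul,
    ← smul_add, add_sub_cancel]

end PiecewiseLinear

/-! ### Correspondence between Euclidean paths and trajectories of the flow. -/

section Paths

variable {d k m : ℕ} (S : CylinderSystem d k) (σ : Fin m → Fin k)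

/-- The base subspaces of the successive collisions. -/
def baseSeq (j : ℕ) : Submodule ℝ (EuclideanSpace ℝ (Fin d)) :=
  -- The flow is indexed by `ℕ`; the values from `m` on are immaterial.
  if h : j < m then S.L (σ ⟨j, h⟩) else ⊥

/-- The radii of the cylinders of the successive collisions. -/
def radiusSeq (j : ℕ) : ℝ :=
  if h : j < m then S.r (σ ⟨j, h⟩) else 1

/-- The translation vectors of the cylinders of the successive collisions. -/
def centerSeq (a : Fin m → EuclideanSpace ℝ (Fin d)) (j : ℕ) : EuclideanSpace ℝ (Fin d) :=
  if h : j < m then a ⟨j, h⟩ else 0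

variable {S σ} {a : Fin m → EuclideanSpace ℝ (Fin d)}

theorem baseSeq_of_lt {j : ℕ} (h : j < m) : baseSeq S σ j = S.L (σ ⟨j, h⟩) := dif_pos h

theorem radiusSeq_of_lt {j : ℕ} (h : j < m) : radiusSeq S σ j = S.r (σ ⟨j, h⟩) := dif_pos h

theorem centerSeq_of_lt {j : ℕ} (h : j < m) : centerSeq a j = a ⟨j, h⟩ := dif_pos h

theorem radiusSeq_pos : ∀ j < m, 0 < radiusSeq S σ j := fun j hj => by
  rw [radiusSeq_of_lt hj]; exact S.r_pos _

theorem two_le_finrank_baseSeq : ∀ j < m, 2 ≤ Module.finrank ℝ (baseSeq S σ j) := fun j hj => by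
  rw [baseSeq_of_lt hj]; exact S.two_le_finrank _

theorem centerSeq_mem (ha : ∀ j, a j ∈ S.L (σ j)) : ∀ j < m, centerSeq a j ∈ baseSeq S σ j :=
  fun j hj => by rw [baseSeq_of_lt hj, centerSeq_of_lt hj]; exact ha _

namespace EuclideanPath

/-- Shifted by `-x`, the path is a trajectory among the cylinders centred at `a`. The time `s` is
that of the latest of the first `j` collisions, or 0 at the start. -/
theorem cylFlow_eq (γ : EuclideanPath S σ) {x : EuclideanSpace ℝ (Fin d)}
    (hx : ∀ j, γ.cylinderPos j = a j + S.P (σ j) x) {j : ℕ} (hj : j ≤ m) :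
    HitsAll (baseSeq S σ) (centerSeq a) (radiusSeq S σ) j (-x, γ.vel 0) ∧
    ∃ s, (∀ i : Fin m, (i : ℕ) < j → γ.time i ≤ s) ∧ (∀ i : Fin m, j ≤ i → s < γ.time i) ∧
      cylFlow (baseSeq S σ) (centerSeq a) (radiusSeq S σ) j (-x, γ.vel 0) =
        (γ.curve s - x, γ.vel ⟨j, Nat.lt_succ_of_le hj⟩) := by
  induction j with
  | zero =>
    refine ⟨fun j hj => absurd hj (Nat.not_lt_zero j), 0, fun i hi => absurd hi (Nat.not_lt_zero _),
      fun i _ => γ.time_pos i, ?_⟩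
    rw [γ.curve_zero, zero_sub]
    rfl
  | succ j ih =>
    obtain ⟨h1, s, hs1, hs2, hflow⟩ := ih (Nat.le_of_succ_le hj)
    have hjm : j < m := hj
    set i : Fin m := ⟨j, hjm⟩ with hi
    have hi1 : (⟨j, Nat.lt_succ_of_le (Nat.le_of_succ_le hj)⟩ : Fin (m + 1)) = i.castSucc := rfl
    have hi2 : (⟨j + 1, Nat.lt_succ_of_le hj⟩ : Fin (m + 1)) = i.succ := rfl
    rw [hi1] at hflow
    rw [hi2]
    set n := ‖γ.jump i‖⁻¹ • γ.jump i with hn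
    have hJ : 0 < ‖γ.jump i‖ := norm_pos_iff.2 (γ.jump_ne_zero i)
    have hnL : n ∈ baseSeq S σ j := by
      rw [baseSeq_of_lt hjm]; exact Submodule.smul_mem _ _ (γ.jump_mem i)
    have hn1 : ‖n‖ = 1 := by rw [hn, norm_smul, norm_inv, norm_norm, inv_mul_cancel₀ hJ.ne']
    have hvn : inner ℝ (γ.vel i.castSucc) n = - (‖γ.jump i‖ / 2) := by
      rw [hn, inner_smul_right, γ.inner_vel_jump]; field_simp
    have hlin : γ.curve (γ.time i) - γ.curve s = ((γ.time i : ℝ) - s) • γ.vel i.castSucc := by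
      refine γ.linear i.castSucc s ⟨fun l hl => hs1 l hl, fun l hl => (hs2 l hl).le⟩ _
        ⟨fun l hl => γ.time_strictMono.monotone (Fin.castSucc_lt_castSucc_iff.1 hl).le,
         fun l hl => γ.time_strictMono.monotone (Fin.castSucc_le_castSucc_iff.1 hl)⟩
    have hpos : (γ.curve s - x) + ((γ.time i : ℝ) - s) • γ.vel i.castSucc =
        γ.curve (γ.time i) - x := by
      rw [← hlin]; abel
    have hhit := hits_of_eq (L := baseSeq S σ j) (c := centerSeq a j) (r := radiusSeq S σ j)
      (z := (γ.curve s - x, γ.vel i.castSucc)) (t := (γ.time i : ℝ) - s) (n := n)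
      (radiusSeq_pos j hjm) (sub_pos.2 (NNReal.coe_lt_coe.2 (hs2 i le_rfl))) hnL hn1
      (by rw [hvn]; linarith) (by
        show (baseSeq S σ j).starProjection ((γ.curve s - x) +
          ((γ.time i : ℝ) - s) • γ.vel i.castSucc) - _ = _
        have h2 := hx i
        rw [cylinderPos, sub_eq_iff_eq_add] at h2
        rw [hpos, baseSeq_of_lt hjm, centerSeq_of_lt hjm, radiusSeq_of_lt hjm, map_sub]
        change S.P (σ i) _ - S.P (σ i) _ - _ = _
        rw [h2]
        abel)
    obtain ⟨hH, hT, hN⟩ := hhit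
    rw [← hflow] at hH hT hN
    refine ⟨fun l hl => ?_, γ.time i, fun l hl => ?_, fun l hl => ?_, ?_⟩
    · rcases Nat.lt_succ_iff_lt_or_eq.1 hl with h | rfl
      · exact h1 l h
      · exact hH
    · exact γ.time_strictMono.monotone (Nat.lt_succ_iff.1 hl)
    · exact γ.time_strictMono hl
    · simp only [cylFlow, collide, hitPos, hN, hT]
      rw [hflow]
      refine Prod.ext hpos ?_
      show γ.vel i.castSucc - (2 * inner ℝ (γ.vel i.castSucc) n) • n = γ.vel i.succ
      have h2 : γ.vel i.succ = γ.vel i.castSucc + γ.jump i := by simp [jump]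
      rw [hvn, h2, hn, smul_smul, sub_eq_add_neg, ← neg_smul]
      congr 1
      have : -(2 * -(‖γ.jump i‖ / 2) * ‖γ.jump i‖⁻¹) = 1 := by field_simp
      rw [this, one_smul]

end EuclideanPath

-- Converse to `cylFlow_eq`: the trajectory, moved so as to start at the origin, is a path whose
-- collision times are the partial sums of the flight times.
open EuclideanPath in
theorem HitsAll.exists_path {z : EuclideanSpace ℝ (Fin d) × EuclideanSpace ℝ (Fin d)}
    (ha : ∀ j, a j ∈ S.L (σ j))
    (h : HitsAll (baseSeq S σ) (centerSeq a) (radiusSeq S σ) m z) (hz : ‖z.2‖ = 1) :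
    ∃ δ : EuclideanPath S σ, δ.vel 0 = z.2 ∧
      δ.finalVel = (cylFlow (baseSeq S σ) (centerSeq a) (radiusSeq S σ) m z).2 ∧
      ∀ j, δ.cylinderPos j = a j + S.P (σ j) (-z.1) := by
  have hbeam := h.beamVariation radiusSeq_pos (centerSeq_mem ha)
  set Φ : ℕ → EuclideanSpace ℝ (Fin d) × EuclideanSpace ℝ (Fin d) := fun j =>
    cylFlow (baseSeq S σ) (centerSeq a) (radiusSeq S σ) j z with hΦ
  set τ : ℕ → ℝ := fun j => flightTime (baseSeq S σ) (centerSeq a) (radiusSeq S σ) j z with hτ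
  set n : ℕ → EuclideanSpace ℝ (Fin d) := fun j =>
    flowNormal (baseSeq S σ) (centerSeq a) (radiusSeq S σ) j z with hn
  have hτpos : ∀ j < m, 0 < τ j := hbeam.time_pos
  let T : ℕ → ℝ≥0 := fun j => ∑ i ∈ Finset.range j, (τ i).toNNReal
  have hTsucc : ∀ j < m, T j < T (j + 1) := fun j hj => by
    simp only [T, Finset.sum_range_succ]
    exact lt_add_of_pos_right _ (Real.toNNReal_pos.2 (hτpos j hj))
  have hTmono : Monotone T := monotone_nat_of_le_succ fun j => by
    simp only [T, Finset.sum_range_succ]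
    exact le_self_add
  -- The shift of index is due to `T 0 = 0`, the starting time.
  let t : Fin m → ℝ≥0 := fun j => T (j + 1)
  let v : Fin (m + 1) → EuclideanSpace ℝ (Fin d) := fun j => (Φ j).2
  have hjump : ∀ j : Fin m, v j.succ - v j.castSucc = -(2 * inner ℝ (Φ j).2 (n j)) • n j := by
    intro j
    have h1 : v j.succ = v j.castSucc - (2 * inner ℝ (Φ j).2 (n j)) • n j := hbeam.vel_succ j j.2
    rw [h1, sub_sub_cancel_left, neg_smul]
  have hcoef : ∀ j : Fin m, 0 < -(2 * inner ℝ (Φ j).2 (n j)) := fun j => by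
    have := hbeam.inner_neg j j.2
    change inner ℝ (Φ j).2 (n j) < 0 at this
    linarith
  have hnj : ∀ j : Fin m, ‖n j‖ = 1 := fun j => hbeam.norm_normal j j.2
  have hnL : ∀ j : Fin m, n j ∈ S.L (σ j) := fun j => by
    have := hbeam.normal_mem j j.2
    rwa [baseSeq_of_lt j.2] at this
  let δ : EuclideanPath S σ :=
    { curve := polygonalCurve t v
      time := t
      vel := v
      curve_zero := by
        have : ∀ i, max (((0 : ℝ≥0) : ℝ) - t i) 0 = 0 := fun i => max_eq_right (by simp)
        simp [polygonalCurve]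
      time_pos := fun j => lt_of_le_of_lt bot_le (hTsucc j j.2)
      time_strictMono := fun i j hij =>
        lt_of_le_of_lt (hTmono (show (i : ℕ) + 1 ≤ j from hij)) (hTsucc j j.2)
      norm_vel := fun j =>
        (h.norm_vel radiusSeq_pos (Nat.lt_succ_iff.1 j.2)).trans hz
      linear := fun j s hs s' hs' => polygonalCurve_sub v hs hs'
      jump_ne_zero := fun j => by
        rw [hjump]
        refine smul_ne_zero (hcoef j).ne' fun h0 => ?_
        have := hnj j
        rw [h0, norm_zero] at this
        exact zero_ne_one this
      jump_mem := fun j => by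
        rw [hjump]
        exact Submodule.smul_mem _ _ (hnL j) }
  have hcurve : ∀ j ≤ m, δ.curve (T j) = (Φ j).1 - z.1 := by
    intro j hj
    induction j with
    | zero =>
      rw [show T 0 = 0 from rfl, δ.curve_zero]
      exact (sub_self z.1).symm
    | succ j ih =>
      have hjm : j < m := hj
      have hseg : ∀ i, j ≤ i → i ≤ j + 1 → T i ∈ timeSegment t (⟨j, hjm⟩ : Fin m).castSucc :=
        fun i h1 h2 => ⟨fun l hl => hTmono ((show (l : ℕ) + 1 ≤ j from hl).trans h1),
          fun l hl => hTmono (h2.trans (Nat.succ_le_succ (show j ≤ l from hl)))⟩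
      have h1 := δ.linear _ _ (hseg j le_rfl (Nat.le_succ j)) _ (hseg (j + 1) (Nat.le_succ j) le_rfl)
      have h2 : ((T (j + 1) : ℝ≥0) : ℝ) - T j = τ j := by
        simp only [T, Finset.sum_range_succ, NNReal.coe_add, add_sub_cancel_left,
          Real.coe_toNNReal _ (hτpos j hjm).le]
      have h3 : (Φ (j + 1)).1 = (Φ j).1 + τ j • (Φ j).2 := rfl
      rw [h2, ih hjm.le, sub_eq_iff_eq_add] at h1
      rw [h1, h3]
      show τ j • (Φ j).2 + _ = _
      abel
  refine ⟨δ, rfl, rfl, fun j => ?_⟩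
  have hj : δ.jump j = -(2 * inner ℝ (Φ j).2 (n j)) • n j := hjump j
  have h1 : ‖δ.jump j‖⁻¹ • δ.jump j = n j := by
    rw [hj, norm_smul, hnj, mul_one, Real.norm_of_nonneg (hcoef j).le,
      inv_smul_smul₀ (hcoef j).ne']
  have h2 : δ.curve (δ.time j) = (Φ (j + 1)).1 - z.1 := hcurve (j + 1) j.2
  have h3 : radiusSeq S σ j • n j = (baseSeq S σ j).starProjection (Φ (j + 1)).1 - centerSeq a j :=
    smul_hitNormal (radiusSeq_pos j j.2).ne'
  rw [baseSeq_of_lt j.2, radiusSeq_of_lt j.2, centerSeq_of_lt j.2] at h3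
  rw [cylinderPos, h1, h2, map_sub, map_neg]
  change S.r (σ j) • n j = S.P (σ j) _ - a j at h3
  rw [h3]
  abel

namespace EuclideanPath

/-- Translating the cylinders by `ε • b` moves the initial state to `(-x - ε • b, γ.vel 0)`. For
small `ε` it still hits all cylinders, so the translated path exists, and by uniqueness it is the
chosen one. The sign does not affect the range. -/
theorem posSubspace_eq_range (γ : EuclideanPath S σ) {x : EuclideanSpace ℝ (Fin d)}
    (ha : ∀ j, a j ∈ S.L (σ j)) (hx : ∀ j, γ.cylinderPos j = a j + S.P (σ j) x) :
    posSubspace γ =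
      (velVar (baseSeq S σ) (centerSeq a) (radiusSeq S σ) m (-x, γ.vel 0)).range := by
  have h := (γ.cylFlow_eq hx le_rfl).1
  set Λ := velVar (baseSeq S σ) (centerSeq a) (radiusSeq S σ) m (-x, γ.vel 0) with hΛ
  have hder : ∀ b, HasDerivAt (fun ε : ℝ => (translate (ε • b) γ).finalVel) (Λ (-b)) 0 := by
    intro b
    let ℓ : ℝ → EuclideanSpace ℝ (Fin d) × EuclideanSpace ℝ (Fin d) := fun ε =>
      (-x - ε • b, γ.vel 0)
    have hℓ0 : ℓ 0 = (-x, γ.vel 0) := by simp [ℓ]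
    have hℓ : HasDerivAt ℓ (-b, 0) 0 := by
      have h1 : HasDerivAt (fun ε : ℝ => -x - ε • b) (-b) 0 := by
        simpa using ((hasDerivAt_id (0 : ℝ)).smul_const b).const_sub (-x)
      exact h1.prodMk (hasDerivAt_const _ _)
    have hℓc : Tendsto ℓ (𝓝 0) (𝓝 (-x, γ.vel 0)) := by
      have := hℓ.continuousAt
      rwa [ContinuousAt, hℓ0] at this
    have hd := (h.contDiffAt_cylFlow le_rfl).snd.differentiableAt one_ne_zero |>.hasFDerivAt
    rw [← hℓ0] at hd
    have h2 := hd.comp_hasDerivAt 0 hℓ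
    rw [hℓ0] at h2
    refine h2.congr_of_eventuallyEq ?_
    filter_upwards [hℓc.eventually h.eventually] with ε hε
    obtain ⟨δ, hδ1, hδ2, hδ3⟩ := hε.exists_path ha (γ.norm_vel 0)
    have htr : IsTranslate (ε • b) γ δ := by
      refine ⟨hδ1, fun j => ?_⟩
      have h3 : -(ℓ ε).1 = x + ε • b := by simp only [ℓ]; abel
      rw [hδ3, hx, h3, map_add]
      abel
    have hex : ∃ δ, IsTranslate (ε • b) γ δ := ⟨δ, htr⟩
    have : translate (ε • b) γ = δ := by
      rw [translate, dif_pos hex]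
      exact hex.choose_spec.unique htr
    rw [this, hδ2]
    rfl
  refine le_antisymm (Submodule.span_le.2 ?_) ?_
  · rintro w ⟨b, hb⟩
    exact ⟨-b, (hder b).unique hb⟩
  · rintro _ ⟨b, rfl⟩
    refine Submodule.subset_span ⟨-b, ?_⟩
    have := hder (-b)
    rw [neg_neg] at this
    exact this

end EuclideanPath

end Paths

end

theorem mainTheorem4 {d k m : ℕ} (S : CylinderSystem d k) (σ : Fin m → Fin k)
    (a : ∀ j, S.L (σ j)) (ha : (EuclideanPath.withRelativePositions S σ a).Nonempty) :
    Delta S σ = DeltaRel S σ a := by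
  have hmem : ∀ {γ : EuclideanPath S σ} {x : EuclideanSpace ℝ (Fin d)},
      (∀ j, γ.cylinderPos j = (a j : EuclideanSpace ℝ (Fin d)) + S.P (σ j) x) ↔
      ∀ j, γ.cylinderPos j - (a j : EuclideanSpace ℝ (Fin d)) = S.P (σ j) x := fun {γ x} =>
    forall_congr' fun j => by rw [sub_eq_iff_eq_add, add_comm]
  have haL : ∀ j, (a j : EuclideanSpace ℝ (Fin d)) ∈ S.L (σ j) := fun j => (a j).2
  have hrel := EuclideanPath.isGreatest_maxDim ha
  have hall := EuclideanPath.isGreatest_maxDim (ha.mono (Set.subset_univ _))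
  refine le_antisymm ?_ ?_
  · obtain ⟨γ', -, hγ'⟩ := hall.1
    obtain ⟨γ, x, hx⟩ := ha
    have hx := hmem.2 hx
    -- A path of maximal dimension is viewed as a trajectory among its own cylinders, with zero
    -- shift.
    have hx' : ∀ j, γ'.cylinderPos j = γ'.cylinderPos j + S.P (σ j) 0 := fun j => by simp
    have h := (γ.cylFlow_eq hx le_rfl).1
    have h' := (γ'.cylFlow_eq hx' le_rfl).1
    obtain ⟨y, hy, hy1, hle⟩ := exists_finrank_velVar_le two_le_finrank_baseSeq radiusSeq_pos
      (centerSeq_mem haL) (centerSeq_mem γ'.cylinderPos_mem) h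
      (norm_ne_zero_iff.1 (by rw [γ.norm_vel 0]; exact one_ne_zero)) h'
    obtain ⟨δ, hδ1, -, hδ⟩ := hy.exists_path haL hy1
    have e1 := γ'.posSubspace_eq_range γ'.cylinderPos_mem hx'
    have e2 := δ.posSubspace_eq_range haL hδ
    rw [hδ1, neg_neg] at e2
    rw [← e1, ← e2] at hle
    calc Delta S σ = Module.finrank ℝ (EuclideanPath.posSubspace γ') := hγ'.symm
      _ ≤ Module.finrank ℝ (EuclideanPath.posSubspace δ) := hle
      _ ≤ DeltaRel S σ a := hrel.2 ⟨δ, ⟨-y.1, hmem.1 hδ⟩, rfl⟩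
  · obtain ⟨γ, -, hγ⟩ := hrel.1
    exact hγ.symm.le.trans (hall.2 ⟨γ, Set.mem_univ γ, rfl⟩)
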